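/- Let $\mathfrak g$ be a finite-dimensional complex semisimple Lie algebra and let $\sigma$ be an indecomposable involution of $\mathfrak g$ (an automorphism of order $2$ such that $\mathfrak g$ is not a direct sum of two non-zero $\sigma$-stable ideals). For $j\in\mathbb Z$ let $\mathfrak g_j$ be the eigenspace of $\sigma$ for the eigenvalue $(-1)^j$. Assume that $\mathfrak g_0$ is semisimple. Let $\mathfrak t_0$ be a Cartan subalgebra of $\mathfrak g_0$, let $\Phi_j$ be the set of non-zero weights of $\mathfrak t_0$ in $\mathfrak g_j$, and let $\Phi_0^+\subset\Phi_0$ be the set of positive roots determined by an element $h_{reg}\in\mathfrak t_0$ that is regular in $\mathfrak g$. Let $\widehat\Phi$ be the set of roots of the twisted affine algebra $\widehat L(\mathfrak g,\sigma)=\bigoplus_{j}(t^j\otimes\mathfrak g_j)\oplus\mathbb CK\oplus\mathbb Cd$ with respect to $\mathfrak t_0\oplus\mathbb CK\oplus\mathbb Cd$; its elements are the weights $\alpha=\mu+j\delta'\neq 0$ with $\mu\in\mathfrak t_0^*$, $j\in\mathbb Z$ and $\mathfrak g_j^\mu\ne0$, where $\delta'(d)=1$ and $\delta'$ vanishes on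 $\mathfrak t_0\oplus \mathbb CK$. Let $(\cdot,\cdot)$ be the symmetric form with $(\mu+i\delta',\nu+j\delta')=(\mu,\nu)$, where $(\mu,\nu)$ is the form on $\mathfrak t_0^*$ induced by the Killing form of $\mathfrak g$, and write $\langle\lambda,\mu^\vee\rangle=2(\lambda,\mu)/(\mu,\mu)$ when $(\mu,\mu)\neq0$. Let $\widehat\Phi^+=\Phi_0^+\cup\{\mu+j\delta'\in\widehat\Phi : j>0\}$, let $\widehat\Pi$ be the corresponding set of simple roots, and let $\alpha_p$ be the unique simple root that is not a root of $\mathfrak g_0$. Assume that $\alpha_p$ is long (of maximal length in $\widehat\Phi$) and non-complex (its restriction to $\mathfrak t_0$ is not in $\Phi_0\cap\Phi_1$). Put $$\mathcal C_\sigma=\{\alpha\in\widehat\Phi^+ : \alpha_p+2\delta'-\alpha\in\widehat\Phi^+\},\qquad \mathcal C^1_\sigma=\{\mu+j\delta'\in\mathcal C_\sigma : j=1\}.$$ Let $\mathcal S$ be a set of pairwise orthogonal elements of $\mathcal C^1_\sigma\setminus\{\alpha_p\}$ which is of maximal cardinality among all such sets. Then $|\mathcal S|\le 4$, and the matrix $A_{\mathcal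 S}=(\langle\eta',\eta^\vee\rangle)_{\eta,\eta'\in\mathcal S\cup\{-\alpha_p\}}$ is a generalized Cartan matrix of affine type. Its type is one of $D_4^{(1)}$, $B_3^{(1)}$, $D_3^{(2)}$, $G_2^{(1)}$, $A_2^{(2)}$. -/

import Mathlib

open Matrix

namespace InvolutionRoots

variable {𝔤 : Type*} [LieRing 𝔤] [LieAlgebra ℂ 𝔤]

/-- `σ` is indecomposable: `𝔤` is not the direct sum of two non-zero `σ`-stable ideals. -/
def IsIndecomposableAut (σ : 𝔤 ≃ₗ⁅ℂ⁆ 𝔤) : Prop :=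
  ∀ I J : LieIdeal ℂ 𝔤, IsCompl I J → (∀ x ∈ I, σ x ∈ I) → (∀ x ∈ J, σ x ∈ J) → I = ⊥ ∨ J = ⊥

/-- The fixed-point subalgebra `𝔤₀` of `σ`. -/
def fixedSubalgebra (σ : 𝔤 ≃ₗ⁅ℂ⁆ 𝔤) : LieSubalgebra ℂ 𝔤 where
  carrier := {x | σ x = x}
  add_mem' := by
    intro a b ha hb
    have ha' : σ a = a := ha
    have hb' : σ b = b := hb
    change σ (a + b) = a + b
    rw [map_add, ha', hb']
  zero_mem' := map_zero σ
  smul_mem' := by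
    intro c x hx
    have hx' : σ x = x := hx
    change σ (c • x) = c • x
    rw [map_smul, hx']
  lie_mem' := by
    intro a b ha hb
    have ha' : σ a = a := ha
    have hb' : σ b = b := hb
    change σ ⁅a, b⁆ = ⁅a, b⁆
    rw [LieEquiv.map_lie, ha', hb']

/-- For an involution `σ` and a subalgebra `𝔱₀` of `𝔤₀`: the `μ`-weight space `𝔤_j^μ` of `𝔱₀` in the
eigenspace `𝔤_j` of `σ` for the eigenvalue `(-1)^j`. It depends on `j` modulo `2` only, and
`t^j ⊗ 𝔤_j^μ` is the weight space of weight `μ + j δ'` in the twisted loop algebra. -/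
def weightSpace (σ : 𝔤 ≃ₗ⁅ℂ⁆ 𝔤) (𝔱₀ : LieSubalgebra ℂ (fixedSubalgebra σ)) (j : ℤ)
    (μ : Module.Dual ℂ 𝔱₀) : Submodule ℂ 𝔤 where
  carrier := {x | σ x = ((-1 : ℂ) ^ j) • x ∧
    ∀ h : 𝔱₀, ⁅((h : fixedSubalgebra σ) : 𝔤), x⁆ = μ h • x}
  add_mem' := by
    rintro a b ⟨ha, ha'⟩ ⟨hb, hb'⟩
    refine ⟨?_, fun h => ?_⟩
    · rw [map_add, ha, hb, smul_add]
    · rw [lie_add, ha', hb', smul_add]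
  zero_mem' := by
    refine ⟨?_, fun h => ?_⟩
    · rw [map_zero, smul_zero]
    · rw [lie_zero, smul_zero]
  smul_mem' := by
    rintro c x ⟨hx, hx'⟩
    refine ⟨?_, fun h => ?_⟩
    · rw [map_smul, hx, smul_comm]
    · rw [lie_smul, hx', smul_comm]

/-- `Φ_j`: the set of non-zero weights of `𝔱₀` in `𝔤_j`. -/
def weights (σ : 𝔤 ≃ₗ⁅ℂ⁆ 𝔤) (𝔱₀ : LieSubalgebra ℂ (fixedSubalgebra σ)) (j : ℤ) :
    Set (Module.Dual ℂ 𝔱₀) :=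
  {μ | μ ≠ 0 ∧ weightSpace σ 𝔱₀ j μ ≠ ⊥}

/-- `h` is a regular element: no element of `Φ = Φ₀ ∪ Φ₁` vanishes on `h`, not even its real part,
so that the sign of the real part of `μ(h)` splits `Φ` into positive and negative weights. -/
def IsRegularElement (σ : 𝔤 ≃ₗ⁅ℂ⁆ 𝔤) (𝔱₀ : LieSubalgebra ℂ (fixedSubalgebra σ)) (h : 𝔱₀) : Prop :=
  ∀ μ ∈ weights σ 𝔱₀ 0 ∪ weights σ 𝔱₀ 1, (μ h).re ≠ 0

/-- Elements of the dual of `𝔱₀ ⊕ ℂ K ⊕ ℂ d` of the form `μ + j δ'` with `μ ∈ 𝔱₀*` and `j ∈ ℤ`,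
written as pairs `(μ, j)`. Here `δ'(d) = 1` and `δ'` vanishes on `𝔱₀` and on `K`. -/
abbrev AffineWeight {σ : 𝔤 ≃ₗ⁅ℂ⁆ 𝔤} (𝔱₀ : LieSubalgebra ℂ (fixedSubalgebra σ)) : Type _ :=
  Module.Dual ℂ 𝔱₀ × ℤ

/-- The affine root system of `σ`: the non-zero weights `μ + j δ'` of `𝔱₀ ⊕ ℂ K ⊕ ℂ d` in
`⨁ t^j ⊗ 𝔤_j`, extended by `K` and `d` (which lie in the zero weight space). -/
def affineRoots (σ : 𝔤 ≃ₗ⁅ℂ⁆ 𝔤) (𝔱₀ : LieSubalgebra ℂ (fixedSubalgebra σ)) :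
    Set (AffineWeight 𝔱₀) :=
  {α | α ≠ 0 ∧ weightSpace σ 𝔱₀ α.2 α.1 ≠ ⊥}

/-- The positive affine roots determined by a regular element `h`: all roots `μ + j δ'` with
`j > 0`, and the positive roots of `𝔤₀`. -/
def positiveRoots (σ : 𝔤 ≃ₗ⁅ℂ⁆ 𝔤) (𝔱₀ : LieSubalgebra ℂ (fixedSubalgebra σ)) (h : 𝔱₀) :
    Set (AffineWeight 𝔱₀) :=
  {α | α ∈ affineRoots σ 𝔱₀ ∧ (0 < α.2 ∨ (α.2 = 0 ∧ 0 < (α.1 h).re))}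

/-- The simple affine roots: the positive roots that are not a sum of two positive roots. -/
def simpleRoots (σ : 𝔤 ≃ₗ⁅ℂ⁆ 𝔤) (𝔱₀ : LieSubalgebra ℂ (fixedSubalgebra σ)) (h : 𝔱₀) :
    Set (AffineWeight 𝔱₀) :=
  {α | α ∈ positiveRoots σ 𝔱₀ h ∧
    ¬ ∃ β ∈ positiveRoots σ 𝔱₀ h, ∃ γ ∈ positiveRoots σ 𝔱₀ h, α = β + γ}

/-- The element `h_μ` of `𝔱₀` with `κ(h_μ, y) = μ(y)` for all `y ∈ 𝔱₀`, for the Killing form `κ`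
of `𝔤`. It exists and is unique by `killingForm_dualElement` and `killingForm_separating`. -/
noncomputable def dualElement {σ : 𝔤 ≃ₗ⁅ℂ⁆ 𝔤} {𝔱₀ : LieSubalgebra ℂ (fixedSubalgebra σ)}
    (μ : Module.Dual ℂ 𝔱₀) : 𝔱₀ :=
  Function.invFun (fun (x : 𝔱₀) (y : 𝔱₀) =>
    killingForm ℂ 𝔤 ((x : fixedSubalgebra σ) : 𝔤) ((y : fixedSubalgebra σ) : 𝔤)) (fun y => μ y)

/-- The Killing form of `𝔤` is non-degenerate on a Cartan subalgebra of the fixed-point algebra of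
an involution. -/
theorem killingForm_separating [FiniteDimensional ℂ 𝔤] [LieAlgebra.IsSemisimple ℂ 𝔤]
    {σ : 𝔤 ≃ₗ⁅ℂ⁆ 𝔤} (hσ : ∀ x, σ (σ x) = x) (𝔱₀ : LieSubalgebra ℂ (fixedSubalgebra σ))
    [𝔱₀.IsCartanSubalgebra] (x : 𝔱₀)
    (hx : ∀ y : 𝔱₀,
      killingForm ℂ 𝔤 ((x : fixedSubalgebra σ) : 𝔤) ((y : fixedSubalgebra σ) : 𝔤) = 0) :
    x = 0 := by
  have h0 : ∀ y : fixedSubalgebra σ, killingForm ℂ 𝔤 ((x : fixedSubalgebra σ) : 𝔤) (y : 𝔤) = 0 := by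
    let B : LinearMap.BilinForm ℂ (fixedSubalgebra σ) :=
      (killingForm ℂ 𝔤).restrict (fixedSubalgebra σ).toSubmodule
    have hB : ∀ (u : 𝔱₀) (m n : fixedSubalgebra σ), B ⁅u, m⁆ n = -B m ⁅u, n⁆ :=
      fun u m n => LieModule.traceForm_apply_lie_apply' ℂ 𝔤 𝔤
        ((u : fixedSubalgebra σ) : 𝔤) (m : 𝔤) (n : 𝔤)
    have hc : Codisjoint (LieAlgebra.rootSpace 𝔱₀ (0 : 𝔱₀ → ℂ))
        (LieModule.posFittingComp ℂ 𝔱₀ (fixedSubalgebra σ)) :=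
      (LieModule.isCompl_genWeightSpace_zero_posFittingComp ℂ 𝔱₀ (fixedSubalgebra σ)).codisjoint
    intro y
    have hy : y ∈ LieAlgebra.rootSpace 𝔱₀ (0 : 𝔱₀ → ℂ) ⊔
        LieModule.posFittingComp ℂ 𝔱₀ (fixedSubalgebra σ) := by
      rw [hc.eq_top]; exact LieSubmodule.mem_top _
    obtain ⟨a, ha, b, hb, rfl⟩ := (LieSubmodule.mem_sup _ _ _).1 hy
    have hx0 : (x : fixedSubalgebra σ) ∈ LieAlgebra.rootSpace 𝔱₀ (0 : 𝔱₀ → ℂ) :=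
      LieAlgebra.le_zeroRootSubalgebra ℂ (fixedSubalgebra σ) 𝔱₀ x.2
    have h1 : B (x : fixedSubalgebra σ) b = 0 :=
      LieModule.eq_zero_of_mem_genWeightSpace_mem_posFitting ℂ 𝔱₀ (fixedSubalgebra σ) hB hx0 hb
    have ha' : a ∈ 𝔱₀ := by
      rw [LieAlgebra.rootSpace_zero_eq] at ha
      exact ha
    have h2 : B (x : fixedSubalgebra σ) a = 0 := hx ⟨a, ha'⟩
    change B (x : fixedSubalgebra σ) (a + b) = 0
    rw [map_add, h1, h2, add_zero]
  have h1 : ∀ z : 𝔤, killingForm ℂ 𝔤 ((x : fixedSubalgebra σ) : 𝔤) z = 0 := by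
    intro z
    have hxσ : σ ((x : fixedSubalgebra σ) : 𝔤) = ((x : fixedSubalgebra σ) : 𝔤) :=
      (x : fixedSubalgebra σ).2
    have hmem : z + σ z ∈ fixedSubalgebra σ := by
      change σ (z + σ z) = z + σ z
      rw [map_add, hσ, add_comm]
    have e1 := h0 ⟨z + σ z, hmem⟩
    have e2 := LieAlgebra.killingForm_of_equiv_apply σ ((x : fixedSubalgebra σ) : 𝔤) z
    rw [hxσ] at e2
    change killingForm ℂ 𝔤 ((x : fixedSubalgebra σ) : 𝔤) (z + σ z) = 0 at e1
    rw [map_add, e2, ← two_mul] at e1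
    exact (mul_eq_zero.1 e1).resolve_left two_ne_zero
  have h2 : ((x : fixedSubalgebra σ) : 𝔤) = 0 := by
    have hk : ((x : fixedSubalgebra σ) : 𝔤) ∈ LinearMap.ker (killingForm ℂ 𝔤) := by
      rw [LinearMap.mem_ker]; ext z; exact h1 z
    rw [LieAlgebra.IsKilling.ker_killingForm_eq_bot] at hk
    exact hk
  exact Subtype.ext (Subtype.ext h2)

theorem killingForm_dualElement [FiniteDimensional ℂ 𝔤] [LieAlgebra.IsSemisimple ℂ 𝔤]
    {σ : 𝔤 ≃ₗ⁅ℂ⁆ 𝔤} (hσ : ∀ x, σ (σ x) = x) (𝔱₀ : LieSubalgebra ℂ (fixedSubalgebra σ))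
    [𝔱₀.IsCartanSubalgebra] (μ : Module.Dual ℂ 𝔱₀) (y : 𝔱₀) :
    killingForm ℂ 𝔤 ((dualElement μ : fixedSubalgebra σ) : 𝔤) ((y : fixedSubalgebra σ) : 𝔤)
      = μ y := by
  let ι : 𝔱₀ →ₗ[ℂ] 𝔤 := (fixedSubalgebra σ).toSubmodule.subtype ∘ₗ 𝔱₀.toSubmodule.subtype
  let f : 𝔱₀ →ₗ[ℂ] Module.Dual ℂ 𝔱₀ := (killingForm ℂ 𝔤).compl₁₂ ι ι
  have hf : Function.Injective f := by
    rw [← LinearMap.ker_eq_bot, LinearMap.ker_eq_bot']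
    intro x hx
    exact killingForm_separating hσ 𝔱₀ x fun y => LinearMap.congr_fun hx y
  have hs : Function.Surjective f :=
    (LinearMap.injective_iff_surjective_of_finrank_eq_finrank
      (Subspace.dual_finrank_eq (K := ℂ) (V := 𝔱₀)).symm).1 hf
  obtain ⟨x, hx⟩ := hs μ
  have h := Function.invFun_eq (f := fun (x : 𝔱₀) (y : 𝔱₀) =>
    killingForm ℂ 𝔤 ((x : fixedSubalgebra σ) : 𝔤) ((y : fixedSubalgebra σ) : 𝔤))
    (b := fun y => μ y) ⟨x, funext fun y => LinearMap.congr_fun hx y⟩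
  exact congrFun h y

/-- The invariant form on weights: `(μ + i δ', ν + j δ') = (μ, ν)`, where `(μ, ν) = κ(h_μ, h_ν)` is
the form on `𝔱₀*` induced by the Killing form; `δ'` is isotropic and orthogonal to `𝔱₀*`. -/
noncomputable def form {σ : 𝔤 ≃ₗ⁅ℂ⁆ 𝔤} {𝔱₀ : LieSubalgebra ℂ (fixedSubalgebra σ)}
    (α β : AffineWeight 𝔱₀) : ℂ :=
  killingForm ℂ 𝔤 ((dualElement α.1 : fixedSubalgebra σ) : 𝔤)
    ((dualElement β.1 : fixedSubalgebra σ) : 𝔤)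

/-- A root is long if no affine root has larger square length; in particular every real root is
long in the simply laced case. (The square lengths of roots are non-negative real numbers.) -/
def IsLong (σ : 𝔤 ≃ₗ⁅ℂ⁆ 𝔤) (𝔱₀ : LieSubalgebra ℂ (fixedSubalgebra σ)) (α : AffineWeight 𝔱₀) : Prop :=
  ∀ β ∈ affineRoots σ 𝔱₀, (form β β).re ≤ (form α α).re

/-- A root is complex if its restriction to `𝔱₀` is a non-zero weight both of `𝔤₀` and of `𝔤₁`. -/
def IsComplexRoot (σ : 𝔤 ≃ₗ⁅ℂ⁆ 𝔤) (𝔱₀ : LieSubalgebra ℂ (fixedSubalgebra σ))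
    (α : AffineWeight 𝔱₀) : Prop :=
  α.1 ∈ weights σ 𝔱₀ 0 ∩ weights σ 𝔱₀ 1

/-- `𝓒_σ`: the positive roots `α` such that `α_p + 2 δ' - α` is again a positive root
(`2 δ' = k δ`, where `δ` is the basic imaginary root and `k` is the order of the diagram
automorphism attached to the involution `σ`). -/
def setC (σ : 𝔤 ≃ₗ⁅ℂ⁆ 𝔤) (𝔱₀ : LieSubalgebra ℂ (fixedSubalgebra σ)) (h : 𝔱₀)
    (αp : AffineWeight 𝔱₀) : Set (AffineWeight 𝔱₀) :=
  {α | α ∈ positiveRoots σ 𝔱₀ h ∧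
    αp + ((0 : Module.Dual ℂ 𝔱₀), (2 : ℤ)) - α ∈ positiveRoots σ 𝔱₀ h}

/-- `𝓒¹_σ`: the elements of `𝓒_σ` of the form `μ + δ'`. -/
def setC1 (σ : 𝔤 ≃ₗ⁅ℂ⁆ 𝔤) (𝔱₀ : LieSubalgebra ℂ (fixedSubalgebra σ)) (h : 𝔱₀)
    (αp : AffineWeight 𝔱₀) : Set (AffineWeight 𝔱₀) :=
  {α | α ∈ setC σ 𝔱₀ h αp ∧ α.2 = 1}

/-- A set of weights is orthogonal if its elements are pairwise orthogonal. -/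
def IsOrthogonalSet {σ : 𝔤 ≃ₗ⁅ℂ⁆ 𝔤} {𝔱₀ : LieSubalgebra ℂ (fixedSubalgebra σ)}
    (S : Set (AffineWeight 𝔱₀)) : Prop :=
  S.Pairwise fun α β => form α β = 0

/-- The matrix `(⟨η', η^∨⟩)` with rows `η` and columns `η'` in `P`, where
`⟨η', η^∨⟩ = 2 (η', η) / (η, η)`. -/
noncomputable def pairingMatrix {σ : 𝔤 ≃ₗ⁅ℂ⁆ 𝔤} {𝔱₀ : LieSubalgebra ℂ (fixedSubalgebra σ)}
    (P : Set (AffineWeight 𝔱₀)) : Matrix P P ℂ :=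
  Matrix.of fun η η' => 2 * form (η' : AffineWeight 𝔱₀) η / form (η : AffineWeight 𝔱₀) η

/-- Generalized Cartan matrices. -/
structure IsGCM {ι : Type*} (A : Matrix ι ι ℤ) : Prop where
  diag : ∀ i, A i i = 2
  nonpos : ∀ i j, i ≠ j → A i j ≤ 0
  symm_zero : ∀ i j, A i j = 0 → A j i = 0

/-- `A` is indecomposable: no splitting of the indices into two non-empty parts makes it block
diagonal. -/
def IsIndecomposableMatrix {ι : Type*} (A : Matrix ι ι ℤ) : Prop :=
  ∀ I : Set ι, I.Nonempty → Iᶜ.Nonempty → ∃ i ∈ I, ∃ j ∈ Iᶜ, A i j ≠ 0 ∨ A j i ≠ 0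

/-- Generalized Cartan matrices of affine type: `A` is indecomposable of corank `1`, there is
`u > 0` with `A u = 0`, and `A v ≥ 0` implies `A v = 0`. -/
structure IsAffineGCM {ι : Type*} [Fintype ι] (A : Matrix ι ι ℤ) : Prop extends IsGCM A where
  indecomposable : IsIndecomposableMatrix A
  corank : (A.map (Int.cast : ℤ → ℝ)).rank + 1 = Fintype.card ι
  exists_pos : ∃ u : ι → ℝ, (∀ i, 0 < u i) ∧ A.map (Int.cast : ℤ → ℝ) *ᵥ u = 0
  eq_zero_of_nonneg : ∀ v : ι → ℝ, 0 ≤ A.map (Int.cast : ℤ → ℝ) *ᵥ v →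
    A.map (Int.cast : ℤ → ℝ) *ᵥ v = 0

/-- `A` is the matrix `M` up to a simultaneous renumbering of rows and columns. -/
def IsOfType {ι κ : Type*} (A : Matrix ι ι ℤ) (M : Matrix κ κ ℤ) : Prop :=
  ∃ e : ι ≃ κ, A.reindex e e = M

/-- Type `D₄⁽¹⁾`. Here and below index `0` is the node joined to all the others, and the entry in
row `i` and column `j` is `⟨α_j, α_i^∨⟩`. -/
def cartanD41 : Matrix (Fin 5) (Fin 5) ℤ :=
  !![ 2, -1, -1, -1, -1;
     -1,  2,  0,  0,  0;
     -1,  0,  2,  0,  0;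
     -1,  0,  0,  2,  0;
     -1,  0,  0,  0,  2]

/-- Type `B₃⁽¹⁾`. -/
def cartanB31 : Matrix (Fin 4) (Fin 4) ℤ :=
  !![ 2, -1, -1, -1;
     -1,  2,  0,  0;
     -1,  0,  2,  0;
     -2,  0,  0,  2]

/-- Type `D₃⁽²⁾`. -/
def cartanD32 : Matrix (Fin 3) (Fin 3) ℤ :=
  !![ 2, -1, -1;
     -2,  2,  0;
     -2,  0,  2]

/-- Type `G₂⁽¹⁾`. -/
def cartanG21 : Matrix (Fin 3) (Fin 3) ℤ :=
  !![ 2, -1, -1;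
     -1,  2,  0;
     -3,  0,  2]

/-- Type `A₂⁽²⁾`. -/
def cartanA22 : Matrix (Fin 2) (Fin 2) ℤ :=
  !![ 2, -1;
     -4,  2]

end InvolutionRoots

open InvolutionRoots

/-! Let τ be the restriction of α_p to `𝔱₀`: a longest weight of 𝔤₁ that is not a root of 𝔤₀. Then
roots of 𝔤₀ take only the values -1, 0, 1 (their level) on the coroot of τ, and η ↦ β = τ - η
identifies `setC1` without α_p with the roots of level 1, preserving inner products. The ratios r =
(τ,τ)/(β,β) are positive integers. Everything reduces to the claim that they sum to 4 over a maximal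
orthogonal S (`sum_eq_four_of_maximal`): the matrix is then a star centred at -α_p, and the
partitions 1+1+1+1, 1+1+2, 2+2, 1+3, 4 give the five types (`isAffineGCM_starMatrix`,
`isOfType_starMatrix`).

For the claim, reflect τ in all the β to get ν = τ - Σ r β, again a longest weight. Since |ν+τ|² =
(4 - Σ r)|τ|², the sum is at most 4. If it is smaller, then ν ≠ -τ, and
`exists_lie_levelVectors_ne_zero` gives a root γ of level 1 with ν - γ a weight, so (ν,γ) > 0 by
maximality of length. All (γ,β) are ≥ 0, because otherwise γ+β would be a root of level 2; some
(γ,β) is non-zero because S is maximal; integrality then gives (ν,γ) ≤ 0, a contradiction.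

The lemma just quoted rests on this: the 𝔤₀-module N generated by a vector v of weight τ is already
generated by vectors of level -1. If these all kill the reflected vector w, then N is isotropic for
the Killing form, so v commutes with N. But the coroot of τ has trace 0 on N (𝔤₀ is perfect),
eigenvalue 2 on v, and no negative eigenvalue if v kills N. -/

namespace InvolutionRoots

variable {𝔤 : Type*} [LieRing 𝔤] [LieAlgebra ℂ 𝔤]

/-! ### Semisimple parts of elements of a semisimple Lie algebra. -/

section General

variable [FiniteDimensional ℂ 𝔤]

open Module.End in
/-- Jordan decomposition in a semisimple Lie algebra. -/
theorem exists_semisimple_part [LieAlgebra.IsKilling ℂ 𝔤] (x : 𝔤) :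
    ∃ y : 𝔤, (LieAlgebra.ad ℂ 𝔤 y).IsSemisimple ∧ IsNilpotent (LieAlgebra.ad ℂ 𝔤 (x - y)) ∧
      (∀ f : Module.End ℂ 𝔤, Commute (LieAlgebra.ad ℂ 𝔤 x) f → Commute (LieAlgebra.ad ℂ 𝔤 y) f) ∧
      ∀ z : 𝔤, ⁅x, z⁆ = 0 → ⁅y, z⁆ = 0 := by
  obtain ⟨N, -, S, hS₀, hN, hS, hSN⟩ := (LieAlgebra.ad ℂ 𝔤 x).exists_isNilpotent_isSemisimple
  have hcomm : ∀ f : Module.End ℂ 𝔤, Commute (LieAlgebra.ad ℂ 𝔤 x) f → Commute S f :=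
    fun f hf => (Algebra.commute_of_mem_adjoin_singleton_of_commute hS₀ hf.symm).symm
  replace hS₀ : Commute (LieAlgebra.ad ℂ 𝔤 x) S := Algebra.commute_of_mem_adjoin_self hS₀
  rw [eq_sub_of_add_eq hSN.symm] at hN
  have aux {c : ℂ} {y : 𝔤} (hy : y ∈ (LieAlgebra.ad ℂ 𝔤 x).maxGenEigenspace c) :
      S y = c • y := by
    rw [maxGenEigenspace_eq] at hy
    rw [apply_eq_of_mem_of_comm_of_isFinitelySemisimple_of_isNil hy hS₀ hS.isFinitelySemisimple hN]
  have htop : ∀ y : 𝔤, y ∈ ⨆ c : ℂ, (LieAlgebra.ad ℂ 𝔤 x).maxGenEigenspace c := fun y => by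
    rw [iSup_maxGenEigenspace_eq_top]; trivial
  -- Brackets add generalised eigenvalues of `ad x`, and S is scalar on each generalised eigenspace;
  -- so S is a derivation, hence inner.
  have h_der (y z : 𝔤) : S ⁅y, z⁆ = ⁅S y, z⁆ + ⁅y, S z⁆ := by
    induction htop y using Submodule.iSup_induction' with
    | mem α y hy =>
      induction htop z using Submodule.iSup_induction' with
      | mem β z hz =>
        have hyz : ⁅y, z⁆ ∈ (LieAlgebra.ad ℂ 𝔤 x).maxGenEigenspace (α + β) :=
          LieModule.lie_mem_maxGenEigenspace_toEnd hy hz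
        rw [aux hy, aux hz, aux hyz, smul_lie, lie_smul, ← add_smul]
      | zero => simp
      | add _ _ _ _ h h' => simp only [lie_add, map_add, h, h']; abel
    | zero => simp
    | add _ _ _ _ h h' => simp only [add_lie, map_add, h, h']; abel
  replace h_der : ∀ y z : 𝔤, S ⁅y, z⁆ = ⁅y, S z⁆ - ⁅z, S y⁆ := by
    simp_rw [← lie_skew (S _) _, add_comm, ← sub_eq_add_neg] at h_der; assumption
  obtain ⟨y, hy⟩ := LieDerivation.IsKilling.exists_eq_ad (⟨S, h_der⟩ : LieDerivation ℂ 𝔤 𝔤)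
  have hyS : LieAlgebra.ad ℂ 𝔤 y = S := by
    rw [← LieDerivation.coe_ad_apply_eq_ad_apply y, hy]
  refine ⟨y, hyS ▸ hS, ?_, hyS ▸ hcomm, fun z hz => ?_⟩
  · rw [map_sub, hyS]; exact hN
  · have : S z = (0 : ℂ) • z := by
      have h0 : z ∈ (LieAlgebra.ad ℂ 𝔤 x).eigenspace 0 := by
        rw [Module.End.mem_eigenspace_iff]; simpa using hz
      exact aux (eigenspace_le_maxGenEigenspace h0)
    rw [← hyS] at this
    simpa using this

end General

/-- The inclusion of `𝔱₀` in `𝔤`. -/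
def incl {σ : 𝔤 ≃ₗ⁅ℂ⁆ 𝔤} (𝔱₀ : LieSubalgebra ℂ (fixedSubalgebra σ)) : 𝔱₀ →ₗ[ℂ] 𝔤 :=
  (fixedSubalgebra σ).toSubmodule.subtype ∘ₗ 𝔱₀.toSubmodule.subtype

/-! ### Weight spaces of `𝔱₀` in 𝔤, and diagonalisability of `𝔱₀`. -/

section Weights

variable {σ : 𝔤 ≃ₗ⁅ℂ⁆ 𝔤} {𝔱₀ : LieSubalgebra ℂ (fixedSubalgebra σ)}

theorem incl_apply (x : 𝔱₀) : incl 𝔱₀ x = ((x : fixedSubalgebra σ) : 𝔤) := rfl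

theorem incl_injective : Function.Injective (incl 𝔱₀) :=
  fun _ _ h => Subtype.ext (Subtype.ext h)

theorem map_incl (x : 𝔱₀) : σ (incl 𝔱₀ x) = incl 𝔱₀ x := (x : fixedSubalgebra σ).2

theorem mem_weightSpace {j : ℤ} {μ : Module.Dual ℂ 𝔱₀} {x : 𝔤} :
    x ∈ weightSpace σ 𝔱₀ j μ ↔ σ x = ((-1 : ℂ) ^ j) • x ∧ ∀ h : 𝔱₀, ⁅incl 𝔱₀ h, x⁆ = μ h • x :=
  Iff.rfl

theorem weightSpace_congr {i j : ℤ} (hij : Even (i - j)) (μ : Module.Dual ℂ 𝔱₀) :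
    weightSpace σ 𝔱₀ i μ = weightSpace σ 𝔱₀ j μ := by
  have : (-1 : ℂ) ^ i = (-1 : ℂ) ^ j := by
    have h := hij.neg_one_zpow (α := ℂ)
    rw [zpow_sub₀ (by norm_num)] at h
    exact (div_eq_one_iff_eq (zpow_ne_zero _ (by norm_num))).1 h
  ext x
  rw [mem_weightSpace, mem_weightSpace, this]

theorem lie_mem_weightSpace {i j : ℤ} {μ ν : Module.Dual ℂ 𝔱₀} {x y : 𝔤}
    (hx : x ∈ weightSpace σ 𝔱₀ i μ) (hy : y ∈ weightSpace σ 𝔱₀ j ν) :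
    ⁅x, y⁆ ∈ weightSpace σ 𝔱₀ (i + j) (μ + ν) := by
  rw [mem_weightSpace] at *
  refine ⟨?_, fun h => ?_⟩
  · rw [LieEquiv.map_lie, hx.1, hy.1, smul_lie, lie_smul, smul_smul, zpow_add₀ (by norm_num)]
  · rw [leibniz_lie, hx.2, hy.2, smul_lie, lie_smul, ← add_smul, LinearMap.add_apply]

theorem mem_weightSpace_sup (hσ : ∀ x, σ (σ x) = x) {μ : Module.Dual ℂ 𝔱₀} {x : 𝔤}
    (hx : ∀ h : 𝔱₀, ⁅incl 𝔱₀ h, x⁆ = μ h • x) :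
    x ∈ weightSpace σ 𝔱₀ 0 μ ⊔ weightSpace σ 𝔱₀ 1 μ := by
  have hσx : ∀ h : 𝔱₀, ⁅incl 𝔱₀ h, σ x⁆ = μ h • σ x := fun h => by
    rw [← map_smul, ← hx, LieEquiv.map_lie, map_incl]
  have : x = (2⁻¹ : ℂ) • (x + σ x) + (2⁻¹ : ℂ) • (x - σ x) := by module
  rw [this]
  refine Submodule.add_mem_sup (Submodule.smul_mem _ _ ?_) (Submodule.smul_mem _ _ ?_)
  · rw [mem_weightSpace]
    refine ⟨?_, fun h => ?_⟩
    · rw [map_add, hσ, zpow_zero, one_smul, add_comm]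
    · rw [lie_add, hx, hσx, smul_add]
  · rw [mem_weightSpace]
    refine ⟨?_, fun h => ?_⟩
    · rw [map_sub, hσ, zpow_one, neg_one_smul, neg_sub]
    · rw [lie_sub, hx, hσx, smul_sub]

variable [𝔱₀.IsCartanSubalgebra]

/-- A fixed element centralising `𝔱₀` normalises it, and a Cartan subalgebra is self-normalising. -/
theorem mem_range_incl_of_forall_lie_eq_zero {x : 𝔤} (hx : σ x = x)
    (h : ∀ y : 𝔱₀, ⁅incl 𝔱₀ y, x⁆ = 0) : ∃ z : 𝔱₀, incl 𝔱₀ z = x := by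
  have : (⟨x, hx⟩ : fixedSubalgebra σ) ∈ 𝔱₀.normalizer := by
    rw [LieSubalgebra.mem_normalizer_iff']
    intro y hy
    have : ⁅y, (⟨x, hx⟩ : fixedSubalgebra σ)⁆ = 0 := Subtype.ext (h ⟨y, hy⟩)
    rw [this]; exact zero_mem _
  rw [LieSubalgebra.IsCartanSubalgebra.self_normalizing] at this
  exact ⟨⟨_, this⟩, rfl⟩

theorem exists_incl_eq_of_mem_weightSpace_zero {j : ℤ} (hj : Even j) {x : 𝔤}
    (hx : x ∈ weightSpace σ 𝔱₀ j 0) : ∃ z : 𝔱₀, incl 𝔱₀ z = x := by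
  rw [mem_weightSpace] at hx
  refine mem_range_incl_of_forall_lie_eq_zero ?_ fun y => ?_
  · rw [hx.1, hj.neg_one_zpow, one_smul]
  · rw [hx.2]; simp

variable [FiniteDimensional ℂ 𝔤] [LieAlgebra.IsSemisimple ℂ (fixedSubalgebra σ)]

theorem lie_incl_incl (x y : 𝔱₀) : ⁅incl 𝔱₀ x, incl 𝔱₀ y⁆ = 0 := by
  have : IsLieAbelian 𝔱₀ :=
    LieAlgebra.IsKilling.instIsLieAbelianOfIsCartanSubalgebra ℂ (fixedSubalgebra σ) 𝔱₀
  have h : ⁅x, y⁆ = 0 := trivial_lie_zero _ _ _ _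
  exact congrArg (incl 𝔱₀) h

theorem incl_mem_weightSpace {j : ℤ} (hj : Even j) (x : 𝔱₀) :
    incl 𝔱₀ x ∈ weightSpace σ 𝔱₀ j 0 := by
  rw [mem_weightSpace]
  refine ⟨?_, fun y => ?_⟩
  · rw [map_incl, hj.neg_one_zpow, one_smul]
  · rw [lie_incl_incl]; simp

variable [LieAlgebra.IsSemisimple ℂ 𝔤]

/-- The semisimple part y of x commutes with all that x commutes with, so it is fixed by σ and
centralises `𝔱₀`; hence y lies in `𝔱₀`. The nilpotent difference x - y commutes with `𝔱₀`, so it is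
Killing-orthogonal to `𝔱₀` and vanishes by non-degeneracy there. -/
theorem isSemisimple_ad_incl (hσ : ∀ x, σ (σ x) = x) (x : 𝔱₀) :
    (LieAlgebra.ad ℂ 𝔤 (incl 𝔱₀ x)).IsSemisimple := by
  obtain ⟨y, hy, hn, hc, hz⟩ := exists_semisimple_part (incl 𝔱₀ x)
  have hσy : σ y = y := by
    have h1 := hc (σ : 𝔤 →ₗ[ℂ] 𝔤) (LinearMap.ext fun z => by
      change ⁅incl 𝔱₀ x, σ z⁆ = σ ⁅incl 𝔱₀ x, z⁆
      rw [LieEquiv.map_lie, map_incl])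
    rw [← sub_eq_zero, ← LieDerivation.IsKilling.ad_apply_eq_zero_iff ℂ 𝔤]
    ext z
    have h2 := LinearMap.congr_fun h1.eq (σ z)
    change ⁅y, σ (σ z)⁆ = σ ⁅y, σ z⁆ at h2
    rw [LieEquiv.map_lie, hσ] at h2
    rw [LieDerivation.ad_apply_apply, sub_lie, ← h2]
    simp
  obtain ⟨y, rfl⟩ := mem_range_incl_of_forall_lie_eq_zero (𝔱₀ := 𝔱₀) hσy fun z => by
    rw [← lie_skew, hz _ (lie_incl_incl _ _), neg_zero]
  have : x - y = 0 := by
    refine killingForm_separating hσ 𝔱₀ _ fun z => ?_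
    have hcomm : Commute (LieAlgebra.ad ℂ 𝔤 (incl 𝔱₀ (x - y))) (LieAlgebra.ad ℂ 𝔤 (incl 𝔱₀ z)) := by
      refine LinearMap.ext fun w => ?_
      change ⁅incl 𝔱₀ (x - y), ⁅incl 𝔱₀ z, w⁆⁆ = ⁅incl 𝔱₀ z, ⁅incl 𝔱₀ (x - y), w⁆⁆
      rw [leibniz_lie, lie_incl_incl, zero_lie, zero_add]
    rw [← map_sub] at hn
    exact (LinearMap.isNilpotent_trace_of_isNilpotent (hcomm.isNilpotent_mul_right hn)).eq_zero
  rwa [sub_eq_zero.1 this]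

theorem genWeightSpace_lie (hσ : ∀ x, σ (σ x) = x) {χ : 𝔱₀ → ℂ} {x : 𝔤}
    (hx : x ∈ LieModule.genWeightSpace 𝔤 χ) (h : 𝔱₀) : ⁅incl 𝔱₀ h, x⁆ = χ h • x := by
  have hx' : x ∈ (LieAlgebra.ad ℂ 𝔤 (incl 𝔱₀ h)).maxGenEigenspace (χ h) :=
    LieModule.genWeightSpace_le_genWeightSpaceOf 𝔤 h χ hx
  rw [(isSemisimple_ad_incl hσ h).isFinitelySemisimple.maxGenEigenspace_eq_eigenspace,
    Module.End.mem_eigenspace_iff] at hx'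
  simpa using hx'

theorem iSup_weightSpace (hσ : ∀ x, σ (σ x) = x) (𝔱₀ : LieSubalgebra ℂ (fixedSubalgebra σ))
    [𝔱₀.IsCartanSubalgebra] :
    ⨆ μ : Module.Dual ℂ 𝔱₀, (weightSpace σ 𝔱₀ 0 μ ⊔ weightSpace σ 𝔱₀ 1 μ) = ⊤ := by
  rw [eq_top_iff]
  intro x _
  have hx : x ∈ ⨆ χ : LieModule.Weight ℂ 𝔱₀ 𝔤, LieModule.genWeightSpace 𝔤 χ := by
    rw [LieModule.iSup_genWeightSpace_eq_top']; trivial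
  induction hx using LieSubmodule.iSup_induction' with
  | mem χ x hx =>
    refine Submodule.mem_iSup_of_mem (LieModule.Weight.toLinear ℂ 𝔱₀ 𝔤 χ) ?_
    exact mem_weightSpace_sup hσ (genWeightSpace_lie hσ hx)
  | zero => exact zero_mem _
  | add _ _ _ _ h h' => exact add_mem (h trivial) (h' trivial)

end Weights

/-- The eigenvalues of the semisimple element of an `sl₂`-triple are integers. -/
theorem exists_int_of_lie_eq_smul {L M : Type*} [LieRing L] [LieAlgebra ℂ L] [AddCommGroup M]
    [Module ℂ M] [LieRingModule L M] [LieModule ℂ L M] [FiniteDimensional ℂ M] {h e f : L}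
    (t : IsSl2Triple h e f) {x : M} (hx0 : x ≠ 0) {c : ℂ} (hx : ⁅h, x⁆ = c • x) :
    ∃ k : ℤ, c = k := by
  -- If no power of e killed x, the vectors e^n x would be eigenvectors for the infinitely many
  -- eigenvalues c + 2n. The last non-zero one is primitive.
  have hzero : ∃ n : ℕ, ((LieModule.toEnd ℂ L M e) ^ n) x = 0 := by
    have hs : (Set.range fun n : ℕ => c + 2 * n).Infinite :=
      Set.infinite_range_of_injective fun n m hnm => by simpa using hnm
    by_contra! contra
    exact hs ((LieModule.toEnd ℂ L M h).eigenvectors_linearIndependent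
      (Set.range fun n : ℕ => c + 2 * n)
      (fun s => ((LieModule.toEnd ℂ L M e) ^ s.2.choose) x)
      (fun s => by
        refine ⟨?_, contra _⟩
        rw [Module.End.mem_eigenspace_iff, LieModule.toEnd_apply_apply,
          t.lie_h_pow_toEnd_e hx]
        congr 1
        exact s.2.choose_spec)).finite
  obtain ⟨n, hn, hn'⟩ := Nat.exists_not_and_succ_of_not_zero_of_exists
    (p := fun n => ((LieModule.toEnd ℂ L M e) ^ n) x = 0) hx0 hzero
  have P : t.HasPrimitiveVectorWith (((LieModule.toEnd ℂ L M e) ^ n) x) (c + 2 * n) :=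
    ⟨hn, t.lie_h_pow_toEnd_e hx n, by rwa [IsSl2Triple.lie_e_pow_toEnd_e]⟩
  obtain ⟨m, hm⟩ := P.exists_nat
  exact ⟨m - 2 * n, by push_cast; linear_combination hm⟩

/-! ### Invariance of the Killing form and orthogonality of weight spaces. -/

section Killing

variable {σ : 𝔤 ≃ₗ⁅ℂ⁆ 𝔤} {𝔱₀ : LieSubalgebra ℂ (fixedSubalgebra σ)}

theorem killingForm_lie (x y z : 𝔤) :
    killingForm ℂ 𝔤 ⁅x, y⁆ z = killingForm ℂ 𝔤 x ⁅y, z⁆ :=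
  LieModule.traceForm_apply_lie_apply ℂ 𝔤 𝔤 x y z

theorem killingForm_lie_left (x y z : 𝔤) :
    killingForm ℂ 𝔤 ⁅x, y⁆ z = - killingForm ℂ 𝔤 y ⁅x, z⁆ :=
  LieModule.traceForm_apply_lie_apply' ℂ 𝔤 𝔤 x y z

theorem killingForm_comm (x y : 𝔤) : killingForm ℂ 𝔤 x y = killingForm ℂ 𝔤 y x :=
  LieModule.traceForm_comm ℂ 𝔤 𝔤 x y

theorem killingForm_eq_zero_of_neg {x y : 𝔤} (i j : ℤ) (hx : σ x = ((-1 : ℂ) ^ i) • x)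
    (hy : σ y = ((-1 : ℂ) ^ j) • y) (hij : ¬ Even (i + j)) : killingForm ℂ 𝔤 x y = 0 := by
  have h := LieAlgebra.killingForm_of_equiv_apply σ x y
  rw [hx, hy, map_smul, map_smul, LinearMap.smul_apply, smul_eq_mul, smul_eq_mul, ← mul_assoc,
    ← zpow_add₀ (by norm_num), add_comm, (Int.not_even_iff_odd.1 hij).neg_one_zpow] at h
  linear_combination (-1 / 2 : ℂ) * h

theorem add_eq_zero_of_killingForm_ne_zero {i j : ℤ} {μ ν : Module.Dual ℂ 𝔱₀} {x y : 𝔤}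
    (hx : x ∈ weightSpace σ 𝔱₀ i μ) (hy : y ∈ weightSpace σ 𝔱₀ j ν)
    (hxy : killingForm ℂ 𝔤 x y ≠ 0) : μ + ν = 0 ∧ Even (i + j) := by
  rw [mem_weightSpace] at *
  refine ⟨?_, ?_⟩
  · ext h
    have := killingForm_lie_left (incl 𝔱₀ h) x y
    rw [hx.2, hy.2, map_smul, map_smul, LinearMap.smul_apply, smul_eq_mul, smul_eq_mul] at this
    refine mul_right_cancel₀ hxy ?_
    simp only [LinearMap.add_apply, LinearMap.zero_apply]
    linear_combination this
  · by_contra h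
    exact hxy (killingForm_eq_zero_of_neg i j hx.1 hy.1 h)

theorem eq_zero_of_forall_killingForm_eq_zero [LieAlgebra.IsKilling ℂ 𝔤] {x : 𝔤}
    (hx : ∀ y, killingForm ℂ 𝔤 x y = 0) : x = 0 := by
  have hk : x ∈ LinearMap.ker (killingForm ℂ 𝔤) := by
    rw [LinearMap.mem_ker]; ext z; exact hx z
  rwa [LieAlgebra.IsKilling.ker_killingForm_eq_bot] at hk

theorem eq_zero_of_forall_lie_eq_zero [FiniteDimensional ℂ 𝔤] [LieAlgebra.IsKilling ℂ 𝔤] {x : 𝔤}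
    (hx : ∀ y : 𝔤, ⁅x, y⁆ = 0) : x = 0 := by
  rw [← LieDerivation.IsKilling.ad_apply_eq_zero_iff ℂ 𝔤]
  ext z
  rw [LieDerivation.ad_apply_apply, hx]; rfl

end Killing

/-! ### The real form of `𝔱₀` and positivity of the Killing form on it. -/

section Real

variable {σ : 𝔤 ≃ₗ⁅ℂ⁆ 𝔤} {𝔱₀ : LieSubalgebra ℂ (fixedSubalgebra σ)}

/-- An element of `𝔱₀` is real if all weights of `𝔤` take real values on it. -/
def IsRealElement (x : 𝔱₀) : Prop :=
  ∀ (j : ℤ) (μ : Module.Dual ℂ 𝔱₀), weightSpace σ 𝔱₀ j μ ≠ ⊥ → (μ x).im = 0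

theorem IsRealElement.add {x y : 𝔱₀} (hx : IsRealElement x) (hy : IsRealElement y) :
    IsRealElement (x + y) := fun j μ hμ => by
  rw [map_add, Complex.add_im, hx j μ hμ, hy j μ hμ, add_zero]

theorem IsRealElement.smul {x : 𝔱₀} (hx : IsRealElement x) (r : ℝ) :
    IsRealElement ((r : ℂ) • x) := fun j μ hμ => by
  rw [map_smul, smul_eq_mul, Complex.im_ofReal_mul, hx j μ hμ, mul_zero]

end Real

section Nilpotent

variable {σ : 𝔤 ≃ₗ⁅ℂ⁆ 𝔤} {𝔱₀ : LieSubalgebra ℂ (fixedSubalgebra σ)} [𝔱₀.IsCartanSubalgebra]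

theorem genWeightSpace_ne_bot_of_weightSpace_ne_bot {j : ℤ} {μ : Module.Dual ℂ 𝔱₀}
    (h : weightSpace σ 𝔱₀ j μ ≠ ⊥) : LieModule.genWeightSpace 𝔤 (μ : 𝔱₀ → ℂ) ≠ ⊥ := by
  obtain ⟨x, hx, hx0⟩ := Submodule.exists_mem_ne_zero_of_ne_bot h
  rw [Ne, LieSubmodule.eq_bot_iff]
  push Not
  refine ⟨x, ?_, hx0⟩
  refine LieModule.weightSpace_le_genWeightSpace 𝔤 _ ((LieModule.mem_weightSpace _ _).2 ?_)
  exact (mem_weightSpace.1 hx).2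

theorem killingForm_incl [FiniteDimensional ℂ 𝔤] (x y : 𝔱₀) :
    killingForm ℂ 𝔤 (incl 𝔱₀ x) (incl 𝔱₀ y) = ∑ χ : LieModule.Weight ℂ 𝔱₀ 𝔤,
      Module.finrank ℂ (LieModule.genWeightSpace 𝔤 χ) • (χ x * χ y) :=
  LieModule.traceForm_eq_sum_finrank_nsmul_mul ℂ 𝔱₀ 𝔤 x y

theorem finite_weights [FiniteDimensional ℂ 𝔤] (𝔱₀ : LieSubalgebra ℂ (fixedSubalgebra σ)) [𝔱₀.IsCartanSubalgebra] (j : ℤ) :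
    {μ : Module.Dual ℂ 𝔱₀ | weightSpace σ 𝔱₀ j μ ≠ ⊥}.Finite := by
  refine (Set.finite_range (LieModule.Weight.toLinear ℂ 𝔱₀ 𝔤)).subset fun μ hμ => ?_
  exact ⟨⟨μ, genWeightSpace_ne_bot_of_weightSpace_ne_bot hμ⟩, rfl⟩

end Nilpotent

section Coroot

variable [FiniteDimensional ℂ 𝔤] {σ : 𝔤 ≃ₗ⁅ℂ⁆ 𝔤} [LieAlgebra.IsSemisimple ℂ (fixedSubalgebra σ)]
  {𝔱₀ : LieSubalgebra ℂ (fixedSubalgebra σ)} [𝔱₀.IsCartanSubalgebra]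

/-- A coroot of 𝔤₀ is the semisimple element of an sl₂-triple in 𝔤₀, which acts on all of 𝔤 with
integer eigenvalues. -/
theorem isRealElement_coroot
    (α : LieModule.Weight ℂ 𝔱₀ (fixedSubalgebra σ)) (hα : α.IsNonZero) :
    IsRealElement (LieAlgebra.IsKilling.coroot α) := by
  intro j μ hμ
  obtain ⟨x, hx, hx0⟩ := Submodule.exists_mem_ne_zero_of_ne_bot hμ
  obtain ⟨h, e, f, ht, he, hf⟩ := LieAlgebra.IsKilling.exists_isSl2Triple_of_weight_isNonZero hα
  have hh := ht.h_eq_coroot hα he hf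
  have hx' : ⁅h, x⁆ = μ (LieAlgebra.IsKilling.coroot α) • x := by
    rw [hh]; exact (mem_weightSpace.1 hx).2 (LieAlgebra.IsKilling.coroot α)
  obtain ⟨k, hk⟩ := exists_int_of_lie_eq_smul ht hx0 hx'
  rw [hk, Complex.intCast_im]

/-- The coroots are real elements and span `𝔱₀`, because 𝔤₀ is semisimple. -/
theorem exists_eq_add_I_smul (x : 𝔱₀) :
    ∃ a b : 𝔱₀, IsRealElement a ∧ IsRealElement b ∧ x = a + Complex.I • b := by
  have hzero : IsRealElement (0 : 𝔱₀) := fun j μ _ => by simp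
  have hx : x ∈ Submodule.span ℂ
      (Set.range (LieAlgebra.IsKilling.rootSystem 𝔱₀).coroot) := by
    rw [RootPairing.IsRootSystem.span_coroot_eq_top]; trivial
  induction hx using Submodule.span_induction with
  | mem x hx =>
    obtain ⟨α, rfl⟩ := hx
    exact ⟨_, 0, isRealElement_coroot α.1 (𝔱₀.isNonZero_coe_root α), hzero, by simp⟩
  | zero => exact ⟨0, 0, hzero, hzero, by simp⟩
  | add x y _ _ hx hy =>
    obtain ⟨a, b, ha, hb, rfl⟩ := hx
    obtain ⟨c, d, hc, hd, rfl⟩ := hy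
    exact ⟨a + c, b + d, ha.add hc, hb.add hd, by module⟩
  | smul c x _ hx =>
    obtain ⟨a, b, ha, hb, rfl⟩ := hx
    refine ⟨(c.re : ℂ) • a + ((-c.im : ℝ) : ℂ) • b, (c.re : ℂ) • b + (c.im : ℂ) • a,
      (ha.smul _).add (hb.smul _), (hb.smul _).add (ha.smul _), ?_⟩
    have hI : ((c.im : ℂ) * Complex.I) • Complex.I • b = (-c.im : ℂ) • b := by
      rw [smul_smul]; congr 1; linear_combination (c.im : ℂ) * Complex.I_mul_I
    nth_rw 1 [← Complex.re_add_im c]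
    rw [smul_add, add_smul, add_smul, hI]
    push_cast
    module

end Coroot

section Cartan

variable [FiniteDimensional ℂ 𝔤] [LieAlgebra.IsSemisimple ℂ 𝔤]
  {σ : 𝔤 ≃ₗ⁅ℂ⁆ 𝔤} {𝔱₀ : LieSubalgebra ℂ (fixedSubalgebra σ)} [𝔱₀.IsCartanSubalgebra]

/-- Both sides lie in `𝔱₀`, where the Killing form is non-degenerate; invariance shows that they
pair equally with `𝔱₀`. -/
theorem lie_eq_killingForm_smul (hσ : ∀ x, σ (σ x) = x) {j : ℤ} {μ : Module.Dual ℂ 𝔱₀} {x y : 𝔤}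
    (hx : x ∈ weightSpace σ 𝔱₀ j μ) (hy : y ∈ weightSpace σ 𝔱₀ (-j) (-μ)) :
    ⁅x, y⁆ = killingForm ℂ 𝔤 x y • incl 𝔱₀ (dualElement μ) := by
  have h := lie_mem_weightSpace hx hy
  rw [add_neg_cancel, add_neg_cancel] at h
  obtain ⟨z, hz⟩ := exists_incl_eq_of_mem_weightSpace_zero Even.zero h
  rw [← hz, ← map_smul, ← sub_eq_zero, ← map_sub]
  rw [killingForm_separating hσ 𝔱₀ (z - killingForm ℂ 𝔤 x y • dualElement μ) fun w => ?_, map_zero]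
  rw [← incl_apply, ← incl_apply, map_sub, map_smul, hz, map_sub, map_smul, LinearMap.sub_apply,
    LinearMap.smul_apply, incl_apply (dualElement μ), incl_apply w,
    killingForm_dualElement hσ 𝔱₀ μ w, ← incl_apply, killingForm_lie, ← lie_skew, map_neg,
    (mem_weightSpace.1 hy).2]
  simp [mul_comm]

theorem weight_apply_dualElement_comm (hσ : ∀ x, σ (σ x) = x) (μ ν : Module.Dual ℂ 𝔱₀) :
    μ (dualElement ν) = ν (dualElement μ) := by
  rw [← killingForm_dualElement hσ 𝔱₀ μ, ← killingForm_dualElement hσ 𝔱₀ ν, killingForm_comm]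

theorem form_eq (hσ : ∀ x, σ (σ x) = x) (α β : AffineWeight 𝔱₀) :
    form α β = α.1 (dualElement β.1) :=
  killingForm_dualElement hσ 𝔱₀ _ _

variable [LieAlgebra.IsSemisimple ℂ (fixedSubalgebra σ)]

theorem induction_weightSpace (hσ : ∀ x, σ (σ x) = x) {p : 𝔤 → Prop}
    (mem : ∀ (j : ℤ) (μ : Module.Dual ℂ 𝔱₀), j = 0 ∨ j = 1 → ∀ x ∈ weightSpace σ 𝔱₀ j μ, p x)
    (add : ∀ x y, p x → p y → p (x + y)) (x : 𝔤) : p x := by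
  have hx : x ∈ ⨆ μ : Module.Dual ℂ 𝔱₀, (weightSpace σ 𝔱₀ 0 μ ⊔ weightSpace σ 𝔱₀ 1 μ) := by
    rw [iSup_weightSpace hσ]; trivial
  induction hx using Submodule.iSup_induction' with
  | mem μ x hx =>
    obtain ⟨y, hy, z, hz, rfl⟩ := Submodule.mem_sup.1 hx
    exact add _ _ (mem 0 μ (.inl rfl) y hy) (mem 1 μ (.inr rfl) z hz)
  | zero => exact mem 0 0 (.inl rfl) 0 (zero_mem _)
  | add _ _ _ _ h h' => exact add _ _ h h'

theorem exists_killingForm_ne_zero (hσ : ∀ x, σ (σ x) = x) {j : ℤ} {μ : Module.Dual ℂ 𝔱₀} {x : 𝔤}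
    (hx : x ∈ weightSpace σ 𝔱₀ j μ) (hx0 : x ≠ 0) :
    ∃ y ∈ weightSpace σ 𝔱₀ (-j) (-μ), killingForm ℂ 𝔤 x y ≠ 0 := by
  by_contra! H
  refine hx0 (eq_zero_of_forall_killingForm_eq_zero fun y => ?_)
  induction y using induction_weightSpace hσ (𝔱₀ := 𝔱₀) with
  | mem i ν hi y hy =>
    by_contra hxy
    obtain ⟨h1, h2⟩ := add_eq_zero_of_killingForm_ne_zero hx hy hxy
    refine hxy (H y ?_)
    rw [← eq_neg_of_add_eq_zero_right h1, weightSpace_congr (j := i)]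
    · exact hy
    · obtain ⟨k, hk⟩ := h2; exact ⟨-k, by omega⟩
  | add y z hy hz => rw [map_add, hy, hz, add_zero]

theorem weightSpace_neg_ne_bot (hσ : ∀ x, σ (σ x) = x) {j : ℤ} {μ : Module.Dual ℂ 𝔱₀}
    (h : weightSpace σ 𝔱₀ j μ ≠ ⊥) : weightSpace σ 𝔱₀ (-j) (-μ) ≠ ⊥ := by
  obtain ⟨x, hx, hx0⟩ := Submodule.exists_mem_ne_zero_of_ne_bot h
  obtain ⟨y, hy, hxy⟩ := exists_killingForm_ne_zero hσ hx hx0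
  exact Submodule.ne_bot_iff _ |>.2 ⟨y, hy, fun h => hxy (by simp [h])⟩

theorem exists_weightSpace_ne_bot (hσ : ∀ x, σ (σ x) = x) (χ : LieModule.Weight ℂ 𝔱₀ 𝔤) :
    ∃ j : ℤ, weightSpace σ 𝔱₀ j (LieModule.Weight.toLinear ℂ 𝔱₀ 𝔤 χ) ≠ ⊥ := by
  obtain ⟨x, hx, hx0⟩ := χ.exists_ne_zero
  have := mem_weightSpace_sup hσ (μ := LieModule.Weight.toLinear ℂ 𝔱₀ 𝔤 χ)
    (genWeightSpace_lie hσ hx)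
  by_contra! H
  rw [H 0, H 1, bot_sup_eq] at this
  exact hx0 this

theorem killingForm_incl_im (hσ : ∀ x, σ (σ x) = x) {x y : 𝔱₀} (hx : IsRealElement x)
    (hy : IsRealElement y) : (killingForm ℂ 𝔤 (incl 𝔱₀ x) (incl 𝔱₀ y)).im = 0 := by
  rw [killingForm_incl, Complex.im_sum]
  refine Finset.sum_eq_zero fun χ _ => ?_
  obtain ⟨j, hj⟩ := exists_weightSpace_ne_bot hσ χ
  have h1 : (χ x).im = 0 := hx j _ hj
  have h2 : (χ y).im = 0 := hy j _ hj
  simp [h1, h2]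

/-- The Killing form on `𝔱₀` is a sum of products of weight values with multiplicities, so on a real
element it is a sum of squares. If all of them vanish, the element is in the radical. -/
theorem killingForm_incl_re_pos (hσ : ∀ x, σ (σ x) = x) {x : 𝔱₀} (hx : IsRealElement x)
    (hx0 : x ≠ 0) : 0 < (killingForm ℂ 𝔤 (incl 𝔱₀ x) (incl 𝔱₀ x)).re := by
  have hre : ∀ χ : LieModule.Weight ℂ 𝔱₀ 𝔤,
      (Module.finrank ℂ (LieModule.genWeightSpace 𝔤 χ) • (χ x * χ x)).re =
        Module.finrank ℂ (LieModule.genWeightSpace 𝔤 χ) * (χ x).re ^ 2 := fun χ => by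
    obtain ⟨j, hj⟩ := exists_weightSpace_ne_bot hσ χ
    have h1 : (χ x).im = 0 := hx j _ hj
    simp [h1, sq]
  rw [killingForm_incl, Complex.re_sum]
  simp_rw [hre]
  refine lt_of_le_of_ne (Finset.sum_nonneg fun χ _ => by positivity) fun h0 => hx0 ?_
  rw [eq_comm, Finset.sum_eq_zero_iff_of_nonneg fun χ _ => by positivity] at h0
  have hχ : ∀ χ : LieModule.Weight ℂ 𝔱₀ 𝔤, χ x = 0 := fun χ => by
    obtain ⟨j, hj⟩ := exists_weightSpace_ne_bot hσ χ
    have h1 : (χ x).im = 0 := hx j _ hj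
    have hpos := LieModule.zero_lt_finrank_genWeightSpace (R := ℂ) χ.genWeightSpace_ne_bot
    have h2 := h0 χ (Finset.mem_univ _)
    rw [mul_eq_zero, pow_eq_zero_iff two_ne_zero, Nat.cast_eq_zero] at h2
    exact Complex.ext (h2.resolve_left hpos.ne') h1
  refine killingForm_separating hσ 𝔱₀ x fun y => ?_
  rw [← incl_apply, ← incl_apply, killingForm_incl]
  exact Finset.sum_eq_zero fun χ _ => by rw [hχ, zero_mul, smul_zero]

/-- Write the dual element as a + ib with a, b real. Its pairing with b is μ(b), a real number, and
has imaginary part κ(b,b); positivity forces b = 0. -/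
theorem isRealElement_dualElement (hσ : ∀ x, σ (σ x) = x) {j : ℤ} {μ : Module.Dual ℂ 𝔱₀}
    (hμ : weightSpace σ 𝔱₀ j μ ≠ ⊥) : IsRealElement (dualElement μ) := by
  obtain ⟨a, b, ha, hb, hab⟩ := exists_eq_add_I_smul (dualElement μ)
  have hb0 : b = 0 := by
    by_contra hb0
    have h1 := killingForm_dualElement hσ 𝔱₀ μ b
    rw [← incl_apply, ← incl_apply, hab, map_add, map_smul, map_add, map_smul] at h1
    have h2 := congrArg Complex.im h1
    rw [hb j μ hμ] at h2
    simp [killingForm_incl_im hσ ha hb] at h2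
    exact (killingForm_incl_re_pos hσ hb hb0).ne' h2
  rw [hab, hb0, smul_zero, add_zero]
  exact ha

end Cartan

/-! ### Root strings: sl₂-triples, integrality, sums and differences of weights. -/

section RealForm

variable [FiniteDimensional ℂ 𝔤] [LieAlgebra.IsSemisimple ℂ 𝔤]
  {σ : 𝔤 ≃ₗ⁅ℂ⁆ 𝔤} {𝔱₀ : LieSubalgebra ℂ (fixedSubalgebra σ)} [𝔱₀.IsCartanSubalgebra]

theorem apply_dualElement_add (hσ : ∀ x, σ (σ x) = x) (μ ν ξ : Module.Dual ℂ 𝔱₀) :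
    μ (dualElement (ν + ξ)) = μ (dualElement ν) + μ (dualElement ξ) := by
  simp only [weight_apply_dualElement_comm hσ μ, LinearMap.add_apply]

theorem apply_dualElement_smul (hσ : ∀ x, σ (σ x) = x) (c : ℂ) (μ ν : Module.Dual ℂ 𝔱₀) :
    μ (dualElement (c • ν)) = c * μ (dualElement ν) := by
  simp only [weight_apply_dualElement_comm hσ μ, LinearMap.smul_apply, smul_eq_mul]

/-- The real part of the form on `𝔱₀*` induced by the Killing form of `𝔤`. -/
noncomputable def realForm (hσ : ∀ x, σ (σ x) = x) (𝔱₀ : LieSubalgebra ℂ (fixedSubalgebra σ))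
    [𝔱₀.IsCartanSubalgebra] : LinearMap.BilinForm ℝ (Module.Dual ℂ 𝔱₀) :=
  LinearMap.mk₂ ℝ (fun μ ν => (μ (dualElement ν)).re)
    (fun μ μ' ν => by simp)
    (fun c μ ν => by simp)
    (fun μ ν ν' => by simp [apply_dualElement_add hσ])
    (fun c μ ν => by
      have := apply_dualElement_smul hσ (c : ℂ) μ ν
      rw [show c • ν = (c : ℂ) • ν from rfl, this]; simp)

theorem realForm_apply (hσ : ∀ x, σ (σ x) = x) (μ ν : Module.Dual ℂ 𝔱₀) :
    realForm hσ 𝔱₀ μ ν = (μ (dualElement ν)).re := rfl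

theorem realForm_comm (hσ : ∀ x, σ (σ x) = x) (μ ν : Module.Dual ℂ 𝔱₀) :
    realForm hσ 𝔱₀ μ ν = realForm hσ 𝔱₀ ν μ := by
  rw [realForm_apply, realForm_apply, weight_apply_dualElement_comm hσ]

theorem form_re (hσ : ∀ x, σ (σ x) = x) (α β : AffineWeight 𝔱₀) :
    (form α β).re = realForm hσ 𝔱₀ α.1 β.1 := by
  rw [form_eq hσ, realForm_apply]

/-- The set of `μ ∈ 𝔱₀*` dual to real elements, as a real subspace. -/
def realDual (hσ : ∀ x, σ (σ x) = x) (𝔱₀ : LieSubalgebra ℂ (fixedSubalgebra σ))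
    [𝔱₀.IsCartanSubalgebra] : Submodule ℝ (Module.Dual ℂ 𝔱₀) where
  carrier := {μ | ∀ (j : ℤ) (ν : Module.Dual ℂ 𝔱₀), weightSpace σ 𝔱₀ j ν ≠ ⊥ →
    (μ (dualElement ν)).im = 0}
  add_mem' := by
    intro a b ha hb j ν hν
    rw [LinearMap.add_apply, Complex.add_im, ha j ν hν, hb j ν hν, add_zero]
  zero_mem' := fun j ν _ => by simp
  smul_mem' := by
    intro c a ha j ν hν
    simp [ha j ν hν]

theorem isRealElement_of_mem_realDual {hσ : ∀ x, σ (σ x) = x} {μ : Module.Dual ℂ 𝔱₀}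
    (hμ : μ ∈ realDual hσ 𝔱₀) : IsRealElement (dualElement μ) := fun j ν hν => by
  rw [weight_apply_dualElement_comm hσ]; exact hμ j ν hν

variable [LieAlgebra.IsSemisimple ℂ (fixedSubalgebra σ)]

theorem mem_realDual (hσ : ∀ x, σ (σ x) = x) {j : ℤ} {μ : Module.Dual ℂ 𝔱₀}
    (hμ : weightSpace σ 𝔱₀ j μ ≠ ⊥) : μ ∈ realDual hσ 𝔱₀ :=
  fun _ _ hν => isRealElement_dualElement hσ hν j μ hμ

theorem apply_dualElement_eq (hσ : ∀ x, σ (σ x) = x) {i j : ℤ} {μ ν : Module.Dual ℂ 𝔱₀}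
    (hμ : weightSpace σ 𝔱₀ i μ ≠ ⊥) (hν : weightSpace σ 𝔱₀ j ν ≠ ⊥) :
    μ (dualElement ν) = realForm hσ 𝔱₀ μ ν :=
  Complex.ext rfl (mem_realDual hσ hμ j ν hν)

theorem form_eq_realForm (hσ : ∀ x, σ (σ x) = x) {i j : ℤ} {α β : AffineWeight 𝔱₀}
    (hα : weightSpace σ 𝔱₀ i α.1 ≠ ⊥) (hβ : weightSpace σ 𝔱₀ j β.1 ≠ ⊥) :
    form α β = realForm hσ 𝔱₀ α.1 β.1 := by
  rw [form_eq hσ, apply_dualElement_eq hσ hα hβ]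

theorem realForm_self_pos {hσ : ∀ x, σ (σ x) = x} {μ : Module.Dual ℂ 𝔱₀}
    (hμ : μ ∈ realDual hσ 𝔱₀) (hμ0 : μ ≠ 0) : 0 < realForm hσ 𝔱₀ μ μ := by
  rw [realForm_apply, ← killingForm_dualElement hσ 𝔱₀]
  refine killingForm_incl_re_pos hσ (isRealElement_of_mem_realDual hμ) fun h => hμ0 ?_
  ext y
  rw [← killingForm_dualElement hσ 𝔱₀ μ y, h]
  simp

theorem realForm_self_nonneg {hσ : ∀ x, σ (σ x) = x} {μ : Module.Dual ℂ 𝔱₀}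
    (hμ : μ ∈ realDual hσ 𝔱₀) : 0 ≤ realForm hσ 𝔱₀ μ μ := by
  rcases eq_or_ne μ 0 with rfl | h
  · simp
  · exact (realForm_self_pos hμ h).le

/-- The coroot `2 h_μ / (μ, μ)`. -/
noncomputable def coweight (hσ : ∀ x, σ (σ x) = x) (μ : Module.Dual ℂ 𝔱₀) : 𝔱₀ :=
  ((2 / realForm hσ 𝔱₀ μ μ : ℝ) : ℂ) • dualElement μ

theorem apply_coweight (hσ : ∀ x, σ (σ x) = x) {i j : ℤ} {μ ν : Module.Dual ℂ 𝔱₀}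
    (hμ : weightSpace σ 𝔱₀ i μ ≠ ⊥) (hν : weightSpace σ 𝔱₀ j ν ≠ ⊥) :
    ν (coweight hσ μ) = ((2 * realForm hσ 𝔱₀ ν μ / realForm hσ 𝔱₀ μ μ : ℝ) : ℂ) := by
  rw [coweight, map_smul, apply_dualElement_eq hσ hν hμ, smul_eq_mul]
  push_cast; ring

theorem exists_isSl2Triple (hσ : ∀ x, σ (σ x) = x) {j : ℤ} {μ : Module.Dual ℂ 𝔱₀} (hμ : μ ≠ 0)
    {x : 𝔤} (hx : x ∈ weightSpace σ 𝔱₀ j μ) (hx0 : x ≠ 0) :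
    ∃ f ∈ weightSpace σ 𝔱₀ (-j) (-μ), IsSl2Triple (incl 𝔱₀ (coweight hσ μ)) x f := by
  have hμw : weightSpace σ 𝔱₀ j μ ≠ ⊥ := (Submodule.ne_bot_iff _).2 ⟨x, hx, hx0⟩
  have hpos := realForm_self_pos (mem_realDual hσ hμw) hμ
  obtain ⟨y, hy, hxy⟩ := exists_killingForm_ne_zero hσ hx hx0
  have h2 : μ (coweight hσ μ) = 2 := by
    rw [apply_coweight hσ hμw hμw, mul_div_assoc, div_self hpos.ne']; simp
  have hf : ((2 / realForm hσ 𝔱₀ μ μ : ℝ) / killingForm ℂ 𝔤 x y : ℂ) • y ∈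
      weightSpace σ 𝔱₀ (-j) (-μ) := Submodule.smul_mem _ _ hy
  refine ⟨_, hf, ?_, ?_, ?_, ?_⟩
  · intro h
    rw [incl_injective (h.trans (map_zero _).symm), map_zero] at h2
    exact two_ne_zero h2.symm
  · rw [lie_smul, lie_eq_killingForm_smul hσ hx hy, smul_smul, div_mul_cancel₀ _ hxy, coweight,
      map_smul]
  · rw [(mem_weightSpace.1 hx).2, h2, two_smul, two_nsmul]
  · rw [(mem_weightSpace.1 hf).2, LinearMap.neg_apply, h2, neg_smul, two_smul, two_nsmul]

theorem exists_int_two_mul_realForm (hσ : ∀ x, σ (σ x) = x) {i j : ℤ} {μ ν : Module.Dual ℂ 𝔱₀}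
    (hμ : weightSpace σ 𝔱₀ i μ ≠ ⊥) (hμ0 : μ ≠ 0) (hν : weightSpace σ 𝔱₀ j ν ≠ ⊥) :
    ∃ k : ℤ, 2 * realForm hσ 𝔱₀ ν μ = k * realForm hσ 𝔱₀ μ μ := by
  obtain ⟨x, hx, hx0⟩ := Submodule.exists_mem_ne_zero_of_ne_bot hμ
  obtain ⟨v, hv, hv0⟩ := Submodule.exists_mem_ne_zero_of_ne_bot hν
  obtain ⟨f, -, t⟩ := exists_isSl2Triple hσ hμ0 hx hx0
  obtain ⟨k, hk⟩ := exists_int_of_lie_eq_smul t hv0 ((mem_weightSpace.1 hv).2 _)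
  rw [apply_coweight hσ hμ hν] at hk
  have hk' : 2 * realForm hσ 𝔱₀ ν μ / realForm hσ 𝔱₀ μ μ = k := by exact_mod_cast hk
  exact ⟨k, (div_eq_iff (realForm_self_pos (mem_realDual hσ hμ) hμ0).ne').1 hk'⟩

/-- If x killed v, then v would be primitive for the sl₂-triple of μ with a negative eigenvalue. -/
theorem weightSpace_add_ne_bot (hσ : ∀ x, σ (σ x) = x) {i j : ℤ} {μ ν : Module.Dual ℂ 𝔱₀}
    (hμ : weightSpace σ 𝔱₀ i μ ≠ ⊥) (hν : weightSpace σ 𝔱₀ j ν ≠ ⊥)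
    (hμν : realForm hσ 𝔱₀ ν μ < 0) : weightSpace σ 𝔱₀ (i + j) (μ + ν) ≠ ⊥ := by
  have hμ0 : μ ≠ 0 := by rintro rfl; simp at hμν
  obtain ⟨x, hx, hx0⟩ := Submodule.exists_mem_ne_zero_of_ne_bot hμ
  obtain ⟨v, hv, hv0⟩ := Submodule.exists_mem_ne_zero_of_ne_bot hν
  obtain ⟨f, -, t⟩ := exists_isSl2Triple hσ hμ0 hx hx0
  refine (Submodule.ne_bot_iff _).2 ⟨⁅x, v⁆, lie_mem_weightSpace hx hv, fun h0 => ?_⟩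
  have P : t.HasPrimitiveVectorWith v (ν (coweight hσ μ)) := ⟨hv0, (mem_weightSpace.1 hv).2 _, h0⟩
  obtain ⟨n, hn⟩ := P.exists_nat
  rw [apply_coweight hσ hμ hν] at hn
  have hn' : 2 * realForm hσ 𝔱₀ ν μ / realForm hσ 𝔱₀ μ μ = n := by exact_mod_cast hn
  have : 2 * realForm hσ 𝔱₀ ν μ / realForm hσ 𝔱₀ μ μ < 0 :=
    div_neg_of_neg_of_pos (by linarith) (realForm_self_pos (mem_realDual hσ hμ) hμ0)
  rw [hn'] at this
  exact absurd this (Nat.cast_nonneg n).not_gt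

theorem weightSpace_sub_ne_bot (hσ : ∀ x, σ (σ x) = x) {i j : ℤ} {μ ν : Module.Dual ℂ 𝔱₀}
    (hμ : weightSpace σ 𝔱₀ i μ ≠ ⊥) (hν : weightSpace σ 𝔱₀ j ν ≠ ⊥)
    (hμν : 0 < realForm hσ 𝔱₀ ν μ) : weightSpace σ 𝔱₀ (j - i) (ν - μ) ≠ ⊥ := by
  have := weightSpace_add_ne_bot hσ (weightSpace_neg_ne_bot hσ hμ) hν (by simpa using hμν)
  rwa [neg_add_eq_sub, neg_add_eq_sub] at this

end RealForm

/-! ### Subspaces stable under 𝔤₀, and the grading of 𝔤₀ by levels. -/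

section Span

/-- The smallest subspace that contains `v` and is stable under the elements of `A`. -/
def stableSpan (A : Set 𝔤) (v : 𝔤) : Submodule ℂ 𝔤 :=
  sInf {p | v ∈ p ∧ ∀ b ∈ A, ∀ x ∈ p, ⁅b, x⁆ ∈ p}

theorem self_mem_stableSpan (A : Set 𝔤) (v : 𝔤) : v ∈ stableSpan A v :=
  Submodule.mem_sInf.2 fun _ hp => hp.1

theorem lie_mem_stableSpan {A : Set 𝔤} {v b x : 𝔤} (hb : b ∈ A) (hx : x ∈ stableSpan A v) :
    ⁅b, x⁆ ∈ stableSpan A v :=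
  Submodule.mem_sInf.2 fun p hp => hp.2 b hb x (Submodule.mem_sInf.1 hx p hp)

theorem stableSpan_le {A : Set 𝔤} {v : 𝔤} {p : Submodule ℂ 𝔤} (hv : v ∈ p)
    (hp : ∀ b ∈ A, ∀ x ∈ p, ⁅b, x⁆ ∈ p) : stableSpan A v ≤ p :=
  sInf_le ⟨hv, hp⟩

/-- Only the action of a on the generator and of the commutators of a with A need checking:
⁅a,⁅b,x⁆⁆ = ⁅⁅a,b⁆,x⁆ + ⁅b,⁅a,x⁆⁆. -/
theorem lie_mem_stableSpan_of_normalizing {A C : Set 𝔤} {v : 𝔤}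
    (hv : ∀ a ∈ C, ⁅a, v⁆ ∈ stableSpan A v)
    (hC : ∀ a ∈ C, ∀ b ∈ A, ∀ x ∈ stableSpan A v, ⁅⁅a, b⁆, x⁆ ∈ stableSpan A v) {a x : 𝔤}
    (ha : a ∈ C) (hx : x ∈ stableSpan A v) : ⁅a, x⁆ ∈ stableSpan A v := by
  have : stableSpan A v ≤ stableSpan A v ⊓ (stableSpan A v).comap (LieAlgebra.ad ℂ 𝔤 a) := by
    refine stableSpan_le ⟨self_mem_stableSpan A v, hv a ha⟩ fun b hb x hx => ?_
    refine ⟨lie_mem_stableSpan hb hx.1, ?_⟩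
    change ⁅a, ⁅b, x⁆⁆ ∈ stableSpan A v
    rw [leibniz_lie]
    exact add_mem (hC a ha b hb x hx.1) (lie_mem_stableSpan hb hx.2)
  exact (this hx).2

end Span

section Stable

variable {σ : 𝔤 ≃ₗ⁅ℂ⁆ 𝔤}

/-- `R` is stable under the fixed-point algebra of `σ`. -/
def IsFixedStable (σ : 𝔤 ≃ₗ⁅ℂ⁆ 𝔤) (R : Submodule ℂ 𝔤) : Prop :=
  ∀ x, σ x = x → ∀ y ∈ R, ⁅x, y⁆ ∈ R

/-- A semisimple algebra is perfect, and commutators act with trace zero. -/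
theorem trace_eq_zero_of_isFixedStable [FiniteDimensional ℂ 𝔤]
    [LieAlgebra.IsSemisimple ℂ (fixedSubalgebra σ)] {R : Submodule ℂ 𝔤} (hR : IsFixedStable σ R)
    (x : fixedSubalgebra σ) :
    LinearMap.trace ℂ R ((LieAlgebra.ad ℂ 𝔤 (x : 𝔤)).restrict (fun y hy => hR x x.2 y hy)) = 0 := by
  let N : LieSubmodule ℂ (fixedSubalgebra σ) 𝔤 := { R with lie_mem := fun {x y} hy => hR x x.2 y hy }
  have hx : x ∈ LieModule.lowerCentralSeries ℂ (fixedSubalgebra σ) (fixedSubalgebra σ) 1 := by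
    have h1 : LieAlgebra.IsKilling ℂ (fixedSubalgebra σ) := inferInstance
    set I : LieIdeal ℂ (fixedSubalgebra σ) := LieModule.lowerCentralSeries ℂ (fixedSubalgebra σ) (fixedSubalgebra σ) 1 with hI
    have hc := (LieIdeal.isCompl_killingCompl (K := ℂ) I).codisjoint
    -- What is Killing-orthogonal to the derived ideal is central by invariance, hence zero.
    have hbot : I.killingCompl = ⊥ := by
      rw [LieSubmodule.eq_bot_iff]
      intro y hy
      refine eq_zero_of_forall_lie_eq_zero fun z => eq_zero_of_forall_killingForm_eq_zero fun w => ?_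
      rw [killingForm_lie, killingForm_comm]
      refine (LieIdeal.mem_killingCompl ℂ _ I).1 hy _ ?_
      rw [hI, LieModule.lowerCentralSeries_succ, LieModule.lowerCentralSeries_zero]
      exact LieSubmodule.lie_mem_lie trivial trivial
    rw [hbot, codisjoint_bot] at hc
    rw [hc]; trivial
  exact LieModule.trace_toEnd_eq_zero_of_mem_lcs ℂ (fixedSubalgebra σ) N le_rfl hx

/-- A non-zero `𝔤₀`-stable subspace of `𝔤` containing an element `e` of an `sl₂`-triple whose
semisimple element lies in `𝔤₀` does not commute with `e`. -/
theorem exists_lie_ne_zero_of_isFixedStable [FiniteDimensional ℂ 𝔤]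
    [LieAlgebra.IsSemisimple ℂ (fixedSubalgebra σ)] {R : Submodule ℂ 𝔤} (hR : IsFixedStable σ R)
    {h e f : 𝔤} (t : IsSl2Triple h e f) (hh : σ h = h) (he : e ∈ R) :
    ∃ y ∈ R, ⁅e, y⁆ ≠ 0 := by
  by_contra! H
  set T : Module.End ℂ R := (LieAlgebra.ad ℂ 𝔤 h).restrict (fun y hy => hR h hh y hy) with hT
  have htr : LinearMap.trace ℂ R T = 0 := trace_eq_zero_of_isFixedStable hR ⟨h, hh⟩
  rw [Module.End.trace_eq_sum_roots_charpoly_of_splits (IsAlgClosed.splits _)] at htr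
  -- If e kills R, every eigenvector of h in R is primitive, so the eigenvalues of h on R are
  -- natural numbers; e contributes 2, so their sum cannot be the trace 0.
  have hroot : ∀ c ∈ T.charpoly.roots, ∃ n : ℕ, c = n := fun c hc => by
    have hc' := (Module.End.hasEigenvalue_iff_isRoot_charpoly T c).2
      (Polynomial.isRoot_of_mem_roots hc)
    obtain ⟨y, hy⟩ := hc'.exists_hasEigenvector
    have h1 : ⁅h, (y : 𝔤)⁆ = c • (y : 𝔤) := congrArg Subtype.val hy.apply_eq_smul
    have P : t.HasPrimitiveVectorWith (y : 𝔤) c :=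
      ⟨fun h0 => hy.2 (Subtype.ext h0), h1, H y y.2⟩
    exact P.exists_nat
  have h2 : (2 : ℂ) ∈ T.charpoly.roots := by
    rw [Polynomial.mem_roots T.charpoly_monic.ne_zero, ← Module.End.hasEigenvalue_iff_isRoot_charpoly]
    refine Module.End.hasEigenvalue_of_hasEigenvector (x := ⟨e, he⟩) ⟨?_, ?_⟩
    · rw [Module.End.mem_eigenspace_iff]
      exact Subtype.ext (t.lie_h_e_smul ℂ)
    · exact fun h0 => t.e_ne_zero (congrArg Subtype.val h0)
  have h3 : (2 : ℝ) ≤ (T.charpoly.roots.map Complex.re).sum := by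
    refine Multiset.single_le_sum (fun c hc => ?_) _ (Multiset.mem_map.2 ⟨2, h2, by simp⟩)
    obtain ⟨d, hd, rfl⟩ := Multiset.mem_map.1 hc
    obtain ⟨n, rfl⟩ := hroot d hd
    simp
  have h4 : (T.charpoly.roots.map Complex.re).sum = 0 := by
    have := map_multiset_sum Complex.reLm T.charpoly.roots
    rw [htr] at this
    simpa using this.symm
  linarith

end Stable

section Level

variable [FiniteDimensional ℂ 𝔤] [LieAlgebra.IsSemisimple ℂ 𝔤]
  {σ : 𝔤 ≃ₗ⁅ℂ⁆ 𝔤} {𝔱₀ : LieSubalgebra ℂ (fixedSubalgebra σ)} [𝔱₀.IsCartanSubalgebra]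

/-- The root vectors of `𝔤₀` whose roots take the value `k` on the coroot of `τ`. -/
def levelVectors (hσ : ∀ x, σ (σ x) = x) (τ : Module.Dual ℂ 𝔱₀) (k : ℤ) : Set 𝔤 :=
  {b | ∃ μ : Module.Dual ℂ 𝔱₀, b ∈ weightSpace σ 𝔱₀ 0 μ ∧
    2 * realForm hσ 𝔱₀ μ τ = k * realForm hσ 𝔱₀ τ τ}

theorem lie_mem_levelVectors {hσ : ∀ x, σ (σ x) = x} {τ : Module.Dual ℂ 𝔱₀} {k l : ℤ} {a b : 𝔤}
    (ha : a ∈ levelVectors hσ τ k) (hb : b ∈ levelVectors hσ τ l) :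
    ⁅a, b⁆ ∈ levelVectors hσ τ (k + l) := by
  obtain ⟨μ, hμ, hμτ⟩ := ha
  obtain ⟨ν, hν, hντ⟩ := hb
  refine ⟨μ + ν, by simpa using lie_mem_weightSpace hμ hν, ?_⟩
  rw [map_add, LinearMap.add_apply]; push_cast
  linear_combination hμτ + hντ

end Level

/-! ### Reflecting long weight vectors inside a 𝔤₀-module. -/

section Module

variable [FiniteDimensional ℂ 𝔤] [LieAlgebra.IsSemisimple ℂ 𝔤]
  {σ : 𝔤 ≃ₗ⁅ℂ⁆ 𝔤} [LieAlgebra.IsSemisimple ℂ (fixedSubalgebra σ)]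
  {𝔱₀ : LieSubalgebra ℂ (fixedSubalgebra σ)} [𝔱₀.IsCartanSubalgebra]

/-- A weight vector of maximal length can be reflected, without leaving the `𝔤₀`-module it
generates, and so that it generates the same module. -/
theorem exists_reflected_weightVector (hσ : ∀ x, σ (σ x) = x) {j : ℤ} {ν β : Module.Dual ℂ 𝔱₀}
    {w : 𝔤} (hw : w ∈ weightSpace σ 𝔱₀ j ν) (hw0 : w ≠ 0)
    (hlong : ∀ μ : Module.Dual ℂ 𝔱₀, weightSpace σ 𝔱₀ j μ ≠ ⊥ →
      realForm hσ 𝔱₀ μ μ ≤ realForm hσ 𝔱₀ ν ν)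
    (hβ : weightSpace σ 𝔱₀ 0 β ≠ ⊥) (hβ0 : β ≠ 0) {r : ℕ}
    (hr : 2 * realForm hσ 𝔱₀ ν β = r * realForm hσ 𝔱₀ β β) :
    ∃ w' ∈ weightSpace σ 𝔱₀ j (ν - (r : ℝ) • β),
      ∀ R : Submodule ℂ 𝔤, IsFixedStable σ R → w' ∈ R → w ∈ R := by
  have hβpos := realForm_self_pos (mem_realDual hσ hβ) hβ0
  have hνw : weightSpace σ 𝔱₀ j ν ≠ ⊥ := (Submodule.ne_bot_iff _).2 ⟨w, hw, hw0⟩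
  obtain ⟨x, hx, hx0⟩ := Submodule.exists_mem_ne_zero_of_ne_bot hβ
  obtain ⟨f, hf, t⟩ := exists_isSl2Triple hσ hβ0 hx hx0
  rw [neg_zero] at hf
  -- Otherwise ν + β would be a weight longer than ν, as (ν,β) ≥ 0.
  have hxw : ⁅x, w⁆ = 0 := by
    by_contra h0
    have hm := lie_mem_weightSpace hx hw
    rw [zero_add] at hm
    have := hlong _ ((Submodule.ne_bot_iff _).2 ⟨_, hm, h0⟩)
    simp only [map_add, LinearMap.add_apply, realForm_comm hσ β ν] at this
    have : (0 : ℝ) ≤ r * realForm hσ 𝔱₀ β β := by positivity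
    linarith
  have P : t.HasPrimitiveVectorWith w (r : ℂ) := by
    refine ⟨hw0, ?_, hxw⟩
    rw [(mem_weightSpace.1 hw).2, apply_coweight hσ hβ hνw, hr, mul_div_assoc,
      div_self hβpos.ne', mul_one, Complex.ofReal_natCast]
  have hmem : ∀ k : ℕ, ((LieModule.toEnd ℂ 𝔤 𝔤 f) ^ k) w ∈
      weightSpace σ 𝔱₀ j (ν - (k : ℝ) • β) := fun k => by
    induction k with
    | zero => simpa using hw
    | succ k ih =>
      rw [← P.lie_f_pow_toEnd_f]
      have := lie_mem_weightSpace hf ih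
      rw [zero_add] at this
      have e : ν - ((k + 1 : ℕ) : ℝ) • β = -β + (ν - (k : ℝ) • β) := by push_cast; module
      rwa [e]
  refine ⟨_, hmem r, fun R hR h => ?_⟩
  have hxσ : σ x = x := by simpa using (mem_weightSpace.1 hx).1
  -- Climb back from f^r w to w: x sends f^(k+1) w to (k+1)(r-k) f^k w, and the coefficient is
  -- non-zero for k < r.
  have key : ∀ k : ℕ, k ≤ r → ((LieModule.toEnd ℂ 𝔤 𝔤 f) ^ k) w ∈ R → w ∈ R := fun k => by
    induction k with
    | zero => intro _ h; simpa using h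
    | succ k ih =>
      intro hk h
      refine ih (by omega) ?_
      have h1 := hR x hxσ _ h
      rw [P.lie_e_pow_succ_toEnd_f] at h1
      refine (Submodule.smul_mem_iff _ ?_).1 h1
      refine mul_ne_zero (by exact_mod_cast k.succ_ne_zero) (sub_ne_zero.2 ?_)
      exact_mod_cast (by omega : r ≠ k)
  exact key r le_rfl h

/-- The roots are pairwise orthogonal, so a reflection in one leaves the pairings with the others
unchanged, and lengths are preserved; single reflections can thus be iterated. -/
theorem exists_multireflected_weightVector (hσ : ∀ x, σ (σ x) = x) {j : ℤ} {τ : Module.Dual ℂ 𝔱₀}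
    {v : 𝔤} (hv : v ∈ weightSpace σ 𝔱₀ j τ) (hv0 : v ≠ 0)
    (hlong : ∀ μ : Module.Dual ℂ 𝔱₀, weightSpace σ 𝔱₀ j μ ≠ ⊥ →
      realForm hσ 𝔱₀ μ μ ≤ realForm hσ 𝔱₀ τ τ)
    {ι : Type*} {β : ι → Module.Dual ℂ 𝔱₀} (hβ : ∀ i, weightSpace σ 𝔱₀ 0 (β i) ≠ ⊥)
    (hβ0 : ∀ i, β i ≠ 0) (horth : ∀ i k, i ≠ k → realForm hσ 𝔱₀ (β i) (β k) = 0) {r : ι → ℕ}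
    (hr : ∀ i, 2 * realForm hσ 𝔱₀ τ (β i) = r i * realForm hσ 𝔱₀ (β i) (β i)) (s : Finset ι) :
    realForm hσ 𝔱₀ (τ - ∑ i ∈ s, (r i : ℝ) • β i) (τ - ∑ i ∈ s, (r i : ℝ) • β i) =
      realForm hσ 𝔱₀ τ τ ∧
    ∃ w ∈ weightSpace σ 𝔱₀ j (τ - ∑ i ∈ s, (r i : ℝ) • β i),
      ∀ R : Submodule ℂ 𝔤, IsFixedStable σ R → w ∈ R → v ∈ R := by
  classical
  induction s using Finset.induction_on with
  | empty => simpa using ⟨v, hv, fun _ _ h => h⟩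
  | insert i s hi ih =>
    obtain ⟨hlen, w, hw, hwv⟩ := ih
    -- Taking R = 0 shows that w = 0 would force v = 0.
    have hw0 : w ≠ 0 := fun h0 => hv0 <| by
      simpa using hwv ⊥ (fun x _ y hy => by simp [(Submodule.mem_bot ℂ).1 hy]) (by simpa using h0)
    have hri : 2 * realForm hσ 𝔱₀ (τ - ∑ i ∈ s, (r i : ℝ) • β i) (β i) =
        r i * realForm hσ 𝔱₀ (β i) (β i) := by
      rw [map_sub, LinearMap.sub_apply, map_sum, LinearMap.sum_apply, Finset.sum_eq_zero, sub_zero,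
        hr]
      intro k hk
      rw [map_smul, LinearMap.smul_apply, horth k i (by rintro rfl; exact hi hk), smul_zero]
    obtain ⟨w', hw', hR⟩ := exists_reflected_weightVector hσ hw hw0 (by rwa [hlen]) (hβ i) (hβ0 i) hri
    rw [Finset.sum_insert hi, add_comm, ← sub_sub]
    refine ⟨?_, w', hw', fun R hR' h => hwv R hR' (hR R hR' h)⟩
    rw [← hlen]
    generalize τ - ∑ i ∈ s, (r i : ℝ) • β i = ν at hri
    simp only [map_sub, LinearMap.sub_apply, map_smul, LinearMap.smul_apply, smul_eq_mul,
      realForm_comm hσ (β i) ν]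
    linear_combination (-r i : ℝ) * hri

/-- Roots of `𝔤₀` take the values `-1`, `0`, `1` on the coroot of a weight `τ` of maximal length
that is not a root of `𝔤₀`. -/
theorem two_mul_realForm_eq_of_isLong (hσ : ∀ x, σ (σ x) = x) {j : ℤ} {τ : Module.Dual ℂ 𝔱₀}
    (hτ : weightSpace σ 𝔱₀ j τ ≠ ⊥) (hτ0 : τ ≠ 0) (hτ' : weightSpace σ 𝔱₀ 0 τ = ⊥)
    (hlong : ∀ (j : ℤ) (μ : Module.Dual ℂ 𝔱₀), weightSpace σ 𝔱₀ j μ ≠ ⊥ →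
      realForm hσ 𝔱₀ μ μ ≤ realForm hσ 𝔱₀ τ τ)
    {μ : Module.Dual ℂ 𝔱₀} (hμ : weightSpace σ 𝔱₀ 0 μ ≠ ⊥) :
    ∃ k : ℤ, (k = -1 ∨ k = 0 ∨ k = 1) ∧ 2 * realForm hσ 𝔱₀ μ τ = k * realForm hσ 𝔱₀ τ τ := by
  have hpos := realForm_self_pos (mem_realDual hσ hτ) hτ0
  -- From |τ - μ|² > 0 and |μ| ≤ |τ|; here μ ≠ τ because τ is not a weight of 𝔤₀. Applied to ±μ,
  -- this bounds the level strictly between -2 and 2.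
  have hlt : ∀ μ : Module.Dual ℂ 𝔱₀, weightSpace σ 𝔱₀ 0 μ ≠ ⊥ →
      2 * realForm hσ 𝔱₀ μ τ < 2 * realForm hσ 𝔱₀ τ τ := fun μ hμ => by
    have hne : τ - μ ≠ 0 := fun h0 => hμ (by rwa [← sub_eq_zero.1 h0])
    have h1 := realForm_self_pos (sub_mem (mem_realDual hσ hτ) (mem_realDual hσ hμ)) hne
    simp only [map_sub, LinearMap.sub_apply, realForm_comm hσ τ μ] at h1
    linarith [hlong 0 μ hμ]
  obtain ⟨k, hk⟩ := exists_int_two_mul_realForm hσ hτ hτ0 hμ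
  have h1 := hlt μ hμ
  have h2 := hlt (-μ) (by simpa using weightSpace_neg_ne_bot hσ hμ)
  rw [map_neg, LinearMap.neg_apply, mul_neg, hk] at h2
  rw [hk] at h1
  have h3 : (k : ℝ) < 2 := by nlinarith
  have h4 : -2 < (k : ℝ) := by nlinarith
  have h3' : k < 2 := by exact_mod_cast h3
  have h4' : -2 < k := by exact_mod_cast h4
  exact ⟨k, by omega, hk⟩

/-- The vectors of level `-1` generate the `𝔤₀`-module generated by a long weight vector that is
not complex. -/
theorem isFixedStable_stableSpan (hσ : ∀ x, σ (σ x) = x) {j : ℤ} {τ : Module.Dual ℂ 𝔱₀}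
    {v : 𝔤} (hv : v ∈ weightSpace σ 𝔱₀ j τ) (hv0 : v ≠ 0) (hτ0 : τ ≠ 0)
    (hτ' : weightSpace σ 𝔱₀ 0 τ = ⊥)
    (hlong : ∀ (j : ℤ) (μ : Module.Dual ℂ 𝔱₀), weightSpace σ 𝔱₀ j μ ≠ ⊥ →
      realForm hσ 𝔱₀ μ μ ≤ realForm hσ 𝔱₀ τ τ) :
    IsFixedStable σ (stableSpan (levelVectors hσ τ (-1)) v) := by
  have hτ : weightSpace σ 𝔱₀ j τ ≠ ⊥ := (Submodule.ne_bot_iff _).2 ⟨v, hv, hv0⟩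
  have hpos := realForm_self_pos (mem_realDual hσ hτ) hτ0
  have hkill : ∀ (μ : Module.Dual ℂ 𝔱₀) (a : 𝔤), a ∈ weightSpace σ 𝔱₀ 0 μ → μ ≠ 0 →
      0 ≤ realForm hσ 𝔱₀ μ τ → ⁅a, v⁆ = 0 := fun μ a ha hμ0 hμ => by
    by_contra h0
    have ha0 : a ≠ 0 := by rintro rfl; simp at h0
    have h1 := realForm_self_pos
      (mem_realDual hσ ((Submodule.ne_bot_iff _).2 ⟨a, ha, ha0⟩)) hμ0
    have h2 := hlong _ _ ((Submodule.ne_bot_iff _).2 ⟨_, lie_mem_weightSpace ha hv, h0⟩)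
    simp only [map_add, LinearMap.add_apply, realForm_comm hσ τ μ] at h2
    linarith
  -- Level 0 normalises level -1. Level 1 then brackets level -1 into level 0, so it is treated
  -- after level 0.
  have hzero : ∀ a ∈ levelVectors hσ τ 0, ∀ x ∈ stableSpan (levelVectors hσ τ (-1)) v,
      ⁅a, x⁆ ∈ stableSpan (levelVectors hσ τ (-1)) v := by
    refine fun a ha x hx => lie_mem_stableSpan_of_normalizing (C := levelVectors hσ τ 0)
      (fun a ha => ?_) (fun a ha b hb x hx => ?_) ha hx
    · obtain ⟨μ, hμ, hμτ⟩ := ha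
      rcases eq_or_ne μ 0 with rfl | hμ0
      · obtain ⟨z, rfl⟩ := exists_incl_eq_of_mem_weightSpace_zero Even.zero hμ
        rw [(mem_weightSpace.1 hv).2]
        exact Submodule.smul_mem _ _ (self_mem_stableSpan _ _)
      · rw [hkill μ a hμ hμ0 (by push_cast at hμτ; linarith)]; exact zero_mem _
    · exact lie_mem_stableSpan (lie_mem_levelVectors ha hb) hx
  have hone : ∀ a ∈ levelVectors hσ τ 1, ∀ x ∈ stableSpan (levelVectors hσ τ (-1)) v,
      ⁅a, x⁆ ∈ stableSpan (levelVectors hσ τ (-1)) v := by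
    refine fun a ha x hx => lie_mem_stableSpan_of_normalizing (C := levelVectors hσ τ 1)
      (fun a ha => ?_) (fun a ha b hb x hx => ?_) ha hx
    · obtain ⟨μ, hμ, hμτ⟩ := ha
      rw [hkill μ a hμ ?_ (by push_cast at hμτ; linarith)]
      · exact zero_mem _
      · rintro rfl; simp at hμτ; exact hpos.ne hμτ
    · exact hzero _ (lie_mem_levelVectors ha hb) x hx
  intro x hx y hy
  -- Symmetrising removes the condition that x is fixed, so that the induction can run over the
  -- weight decomposition of all of 𝔤; components in 𝔤₁ contribute zero.
  have : x = (2⁻¹ : ℂ) • (x + σ x) := by rw [hx]; module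
  rw [this, smul_lie]
  refine Submodule.smul_mem _ _ ?_
  clear this hx
  induction x using induction_weightSpace hσ (𝔱₀ := 𝔱₀) with
  | mem i μ hi x hx =>
    rcases hi with rfl | rfl
    · have hσx : σ x = x := by simpa using (mem_weightSpace.1 hx).1
      rw [hσx, ← two_smul ℂ, smul_lie]
      refine Submodule.smul_mem _ _ ?_
      rcases eq_or_ne x 0 with rfl | hx0
      · simp
      obtain ⟨k, hk, hkτ⟩ := two_mul_realForm_eq_of_isLong hσ hτ hτ0 hτ' hlong
        ((Submodule.ne_bot_iff _).2 ⟨x, hx, hx0⟩)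
      rcases hk with rfl | rfl | rfl
      · exact lie_mem_stableSpan ⟨μ, hx, hkτ⟩ hy
      · exact hzero x ⟨μ, hx, hkτ⟩ y hy
      · exact hone x ⟨μ, hx, hkτ⟩ y hy
    · have hσx : σ x = -x := by simpa using (mem_weightSpace.1 hx).1
      rw [hσx, add_neg_cancel, zero_lie]; exact zero_mem _
  | add x z hx hz =>
    have e : x + z + σ (x + z) = (x + σ x) + (z + σ z) := by rw [map_add]; abel
    rw [e, add_lie]; exact add_mem hx hz

/-- In the `𝔤₀`-module generated by a long weight vector `v` of `𝔤₁` that is not complex, a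
weight vector that generates `v` and has weight different from `-τ` is not killed by all vectors of
level `-1`. -/
theorem exists_lie_levelVectors_ne_zero (hσ : ∀ x, σ (σ x) = x) {τ ν : Module.Dual ℂ 𝔱₀}
    {v w : 𝔤} (hv : v ∈ weightSpace σ 𝔱₀ 1 τ) (hv0 : v ≠ 0) (hτ0 : τ ≠ 0)
    (hτ' : weightSpace σ 𝔱₀ 0 τ = ⊥)
    (hlong : ∀ (j : ℤ) (μ : Module.Dual ℂ 𝔱₀), weightSpace σ 𝔱₀ j μ ≠ ⊥ →
      realForm hσ 𝔱₀ μ μ ≤ realForm hσ 𝔱₀ τ τ)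
    (hw : w ∈ weightSpace σ 𝔱₀ 1 ν) (hν : ν + τ ≠ 0)
    (hwv : ∀ R : Submodule ℂ 𝔤, IsFixedStable σ R → w ∈ R → v ∈ R) :
    ∃ b ∈ levelVectors hσ τ (-1), ⁅b, w⁆ ≠ 0 := by
  by_contra! H
  set N := stableSpan (levelVectors hσ τ (-1)) v with hN
  have hNs : IsFixedStable σ N := isFixedStable_stableSpan hσ hv hv0 hτ0 hτ' hlong
  have hN1 : ∀ x ∈ N, σ x = -x := by
    let p : Submodule ℂ 𝔤 := LinearMap.ker ((σ : 𝔤 →ₗ[ℂ] 𝔤) + LinearMap.id)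
    have hp : ∀ x, x ∈ p ↔ σ x = -x := fun x => by
      rw [LinearMap.mem_ker]; exact add_eq_zero_iff_eq_neg
    have : N ≤ p := by
      refine stableSpan_le ((hp v).2 (by simpa using (mem_weightSpace.1 hv).1)) ?_
      rintro b ⟨μ, hμ, -⟩ x hx
      have hb : σ b = b := by simpa using (mem_weightSpace.1 hμ).1
      rw [hp] at hx ⊢
      rw [LieEquiv.map_lie, hb, hx, lie_neg]
    exact fun x hx => (hp x).1 (this hx)
  -- w is orthogonal to v since ν ≠ -τ, and κ(w,⁅b,x⁆) = κ(⁅w,b⁆,x) = 0 for b of level -1.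
  have hwN : ∀ z ∈ N, killingForm ℂ 𝔤 w z = 0 := by
    have : N ≤ LinearMap.ker (killingForm ℂ 𝔤 w) := by
      refine stableSpan_le ?_ fun b hb x hx => ?_
      · rw [LinearMap.mem_ker]
        by_contra h0
        exact hν (add_eq_zero_of_killingForm_ne_zero hw hv h0).1
      · rw [LinearMap.mem_ker, ← killingForm_lie, ← lie_skew, H b hb, neg_zero, map_zero]; rfl
    exact fun z hz => this hz
  let N' : Submodule ℂ 𝔤 :=
    { carrier := {y | ∀ z ∈ N, killingForm ℂ 𝔤 y z = 0}
      add_mem' := fun {a b} ha hb z hz => by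
        rw [map_add, LinearMap.add_apply, ha z hz, hb z hz, add_zero]
      zero_mem' := fun z _ => by simp
      smul_mem' := fun c a ha z hz => by
        rw [map_smul, LinearMap.smul_apply, ha z hz, smul_zero] }
  have hN's : IsFixedStable σ N' := fun x hx y hy z hz => by
    rw [killingForm_lie_left, hy _ (hNs x hx z hz), neg_zero]
  have hvN' : v ∈ N' := hwv N' hN's hwN
  -- N is isotropic: its orthogonal space is 𝔤₀-stable and contains w, hence v.
  have hNN' : N ≤ N' := stableSpan_le hvN' fun b hb x hx => by
    obtain ⟨μ, hμ, -⟩ := hb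
    exact hN's b (by simpa using (mem_weightSpace.1 hμ).1) x hx
  obtain ⟨f, -, t⟩ := exists_isSl2Triple hσ hτ0 hv hv0
  obtain ⟨y, hy, hvy⟩ := exists_lie_ne_zero_of_isFixedStable hNs t (map_incl _)
    (self_mem_stableSpan _ v)
  -- ⁅v,y⁆ lies in 𝔤₀, hence is orthogonal to 𝔤₁; against 𝔤₀ it pairs to zero by invariance and
  -- isotropy of N.
  refine hvy (eq_zero_of_forall_killingForm_eq_zero fun z => ?_)
  have hz : z = (2⁻¹ : ℂ) • (z + σ z) + (2⁻¹ : ℂ) • (z - σ z) := by module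
  rw [hz, map_add, map_smul, map_smul]
  have h1 : killingForm ℂ 𝔤 ⁅v, y⁆ (z + σ z) = 0 := by
    rw [killingForm_lie, ← lie_skew, map_neg, neg_eq_zero]
    exact hNN' (self_mem_stableSpan _ v) _ (hNs _ (by rw [map_add, hσ, add_comm]) y hy)
  have h2 : killingForm ℂ 𝔤 ⁅v, y⁆ (z - σ z) = 0 := by
    refine killingForm_eq_zero_of_neg (σ := σ) 0 1 ?_ ?_ (by decide)
    · rw [LieEquiv.map_lie, hN1 v (self_mem_stableSpan _ v), hN1 y hy]; simp
    · rw [map_sub, hσ]; simp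
  rw [h1, h2]; simp

end Module

/-! ### Star-shaped generalized Cartan matrices with edge multiplicities summing to 4. -/

section Star

variable {n : ℕ}

/-- The matrix of a star with centre `0` whose leaves are joined to the centre by `r i`-fold
edges. -/
def starMatrix (r : Fin n → ℕ) : Matrix (Fin (n + 1)) (Fin (n + 1)) ℤ :=
  Matrix.of (Fin.cons (Fin.cons 2 fun _ => -1)
    fun i => Fin.cons (-(r i : ℤ)) fun j => if i = j then 2 else 0)

variable (r : Fin n → ℕ)

@[simp] theorem starMatrix_zero_zero : starMatrix r 0 0 = 2 := rfl

@[simp] theorem starMatrix_zero_succ (j : Fin n) : starMatrix r 0 j.succ = -1 := rfl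

@[simp] theorem starMatrix_succ_zero (i : Fin n) : starMatrix r i.succ 0 = -r i := rfl

@[simp] theorem starMatrix_succ_succ (i j : Fin n) :
    starMatrix r i.succ j.succ = if i = j then 2 else 0 := rfl

theorem starMatrix_mulVec_zero (v : Fin (n + 1) → ℝ) :
    ((starMatrix r).map (Int.cast : ℤ → ℝ) *ᵥ v) 0 = 2 * v 0 - ∑ i : Fin n, v i.succ := by
  simp [Matrix.mulVec, dotProduct, Fin.sum_univ_succ, sub_eq_add_neg]

theorem starMatrix_mulVec_succ (v : Fin (n + 1) → ℝ) (i : Fin n) :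
    ((starMatrix r).map (Int.cast : ℤ → ℝ) *ᵥ v) i.succ = 2 * v i.succ - r i * v 0 := by
  simp [Matrix.mulVec, dotProduct, Fin.sum_univ_succ, sub_eq_add_neg, add_comm]

theorem starMatrix_mulVec_eq_zero_iff {r : Fin n → ℕ} (hr : ∑ i, r i = 4)
    (v : Fin (n + 1) → ℝ) : (starMatrix r).map (Int.cast : ℤ → ℝ) *ᵥ v = 0 ↔
      ∀ i : Fin n, 2 * v i.succ = r i * v 0 := by
  have hr' : ∑ i, (r i : ℝ) = 4 := by exact_mod_cast hr
  constructor
  · intro h i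
    have := congrFun h i.succ
    rw [starMatrix_mulVec_succ] at this
    simpa [sub_eq_zero] using this
  · intro h
    ext i
    refine Fin.cases ?_ (fun i => ?_) i
    · rw [starMatrix_mulVec_zero]
      have : 2 * ∑ i : Fin n, v i.succ = 4 * v 0 := by
        rw [Finset.mul_sum, Finset.sum_congr rfl fun i _ => h i, ← Finset.sum_mul, hr']
      simp only [Pi.zero_apply]; linarith
    · rw [starMatrix_mulVec_succ, h, sub_self]; rfl

theorem isAffineGCM_starMatrix {r : Fin n → ℕ} (hpos : ∀ i, 0 < r i) (hr : ∑ i, r i = 4) :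
    IsAffineGCM (starMatrix r) where
  diag i := by refine Fin.cases ?_ (fun i => ?_) i <;> simp
  nonpos i j := by
    refine Fin.cases ?_ (fun i => ?_) i <;> refine Fin.cases ?_ (fun j => ?_) j
    · simp
    · simp
    · simp
    · intro h
      have : i ≠ j := fun e => h (congrArg _ e)
      simp [this]
  symm_zero i j := by
    refine Fin.cases ?_ (fun i => ?_) i <;> refine Fin.cases ?_ (fun j => ?_) j
    · simp
    · simp
    · simpa using (hpos i).ne'
    · by_cases h : i = j
      · simp [h]
      · simp [h, Ne.symm h]
  indecomposable := by
    intro I hI hI'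
    by_cases h0 : (0 : Fin (n + 1)) ∈ I
    · obtain ⟨j, hj⟩ := hI'
      obtain ⟨j, rfl⟩ := Fin.exists_succ_eq.2 (fun e : j = 0 => hj (e ▸ h0))
      exact ⟨0, h0, _, hj, by simp⟩
    · obtain ⟨i, hi⟩ := hI
      obtain ⟨i, rfl⟩ := Fin.exists_succ_eq.2 (fun e : i = 0 => h0 (e ▸ hi))
      exact ⟨_, hi, 0, h0, by simp⟩
  corank := by
    let u : Fin (n + 1) → ℝ := Fin.cons 2 fun i => r i
    have hker : LinearMap.ker ((starMatrix r).map (Int.cast : ℤ → ℝ)).mulVecLin =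
        Submodule.span ℝ {u} := by
      ext v
      rw [LinearMap.mem_ker, Matrix.mulVecLin_apply, starMatrix_mulVec_eq_zero_iff hr,
        Submodule.mem_span_singleton]
      constructor
      · intro h
        refine ⟨v 0 / 2, funext fun i => ?_⟩
        refine Fin.cases ?_ (fun i => ?_) i
        · simp [u]
        · have := h i
          simp only [u, Pi.smul_apply, Fin.cons_succ, smul_eq_mul]
          linarith
      · rintro ⟨c, rfl⟩ i
        simp only [u, Pi.smul_apply, Fin.cons_succ, Fin.cons_zero, smul_eq_mul]
        ring
    have hu : u ≠ 0 := fun h => by simpa [u] using congrFun h 0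
    have h1 := ((starMatrix r).map (Int.cast : ℤ → ℝ)).mulVecLin.finrank_range_add_finrank_ker
    rw [hker, finrank_span_singleton hu, Module.finrank_fintype_fun_eq_card] at h1
    exact h1
  exists_pos := by
    refine ⟨Fin.cons 2 fun i => r i, fun i => ?_, ?_⟩
    · refine Fin.cases ?_ (fun i => ?_) i
      · simp
      · simpa using hpos i
    · rw [starMatrix_mulVec_eq_zero_iff hr]
      intro i
      simp [mul_comm]
  eq_zero_of_nonneg := by
    intro v hv
    rw [starMatrix_mulVec_eq_zero_iff hr]
    have hr' : ∑ i, (r i : ℝ) = 4 := by exact_mod_cast hr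
    have h0 := hv 0
    rw [starMatrix_mulVec_zero, Pi.zero_apply] at h0
    have h1 : ∀ i ∈ Finset.univ, 0 ≤ 2 * v i.succ - r i * v 0 := fun i _ => by
      have := hv i.succ
      rwa [starMatrix_mulVec_succ] at this
    -- Twice the central row plus all leaf rows is zero. As each entry of the product is
    -- non-negative, all leaf entries vanish.
    have h2 : ∑ i, (2 * v i.succ - r i * v 0) = 2 * ∑ i : Fin n, v i.succ - 4 * v 0 := by
      rw [Finset.sum_sub_distrib, ← Finset.mul_sum, ← Finset.sum_mul, hr']
    have h3 := (Finset.sum_eq_zero_iff_of_nonneg h1).1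
      (le_antisymm (by rw [h2]; linarith) (Finset.sum_nonneg h1))
    intro i
    have := h3 i (Finset.mem_univ i)
    linarith

theorem IsAffineGCM.submatrix {ι κ : Type*} [Fintype ι] [Fintype κ] {A : Matrix κ κ ℤ}
    (hA : IsAffineGCM A) (e : ι ≃ κ) : IsAffineGCM (A.submatrix e e) where
  diag i := hA.diag _
  nonpos i j h := hA.nonpos _ _ (e.injective.ne h)
  symm_zero i j := hA.symm_zero _ _
  indecomposable I hI hI' := by
    obtain ⟨i, hi, j, hj, h⟩ := hA.indecomposable (e.symm ⁻¹' I)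
      (hI.preimage e.symm.surjective) (hI'.preimage e.symm.surjective)
    exact ⟨_, hi, _, hj, by simpa using h⟩
  corank := by
    rw [← Matrix.submatrix_map, Matrix.rank_submatrix, Fintype.card_congr e]
    exact hA.corank
  exists_pos := by
    obtain ⟨u, hu, hu'⟩ := hA.exists_pos
    refine ⟨u ∘ e, fun i => hu _, ?_⟩
    rw [← Matrix.submatrix_map, Matrix.submatrix_mulVec_equiv]
    simp [Function.comp_assoc, hu']
  eq_zero_of_nonneg v hv := by
    rw [← Matrix.submatrix_map, Matrix.submatrix_mulVec_equiv] at hv ⊢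
    rw [hA.eq_zero_of_nonneg (v ∘ e.symm) fun i => by simpa using hv (e.symm i)]
    rfl

theorem isOfType_starMatrix {r : Fin n → ℕ} (hpos : ∀ i, 0 < r i) (hr : ∑ i, r i = 4)
    (hmono : Monotone r) {ι : Type*} (e : ι ≃ Fin (n + 1)) :
    IsOfType ((starMatrix r).submatrix e e) cartanD41 ∨
    IsOfType ((starMatrix r).submatrix e e) cartanB31 ∨
    IsOfType ((starMatrix r).submatrix e e) cartanD32 ∨
    IsOfType ((starMatrix r).submatrix e e) cartanG21 ∨
    IsOfType ((starMatrix r).submatrix e e) cartanA22 := by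
  have key : ∀ M : Matrix (Fin (n + 1)) (Fin (n + 1)) ℤ, starMatrix r = M →
      IsOfType ((starMatrix r).submatrix e e) M := fun M hM => ⟨e, by ext; simp [hM]⟩
  -- The r i are positive with sum 4, so monotone r runs through the five partitions of 4.
  have hn : n ≤ 4 := by
    rw [← hr]
    simpa using Finset.card_nsmul_le_sum Finset.univ r 1 fun i _ => hpos i
  interval_cases n
  · simp at hr
  · rw [Fin.sum_univ_one] at hr
    obtain rfl : r = ![4] := by ext i; fin_cases i; exact hr
    exact .inr <| .inr <| .inr <| .inr <| key _ (by decide)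
  · rw [Fin.sum_univ_two] at hr
    have h1 := hmono (by decide : (0 : Fin 2) ≤ 1)
    have h0 := hpos 0
    rcases (by omega : (r 0 = 1 ∧ r 1 = 3) ∨ (r 0 = 2 ∧ r 1 = 2)) with ⟨ha, hb⟩ | ⟨ha, hb⟩
    · obtain rfl : r = ![1, 3] := by ext i; fin_cases i <;> assumption
      exact .inr <| .inr <| .inr <| .inl <| key _ (by decide)
    · obtain rfl : r = ![2, 2] := by ext i; fin_cases i <;> assumption
      exact .inr <| .inr <| .inl <| key _ (by decide)
  · rw [Fin.sum_univ_three] at hr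
    have h1 := hmono (by decide : (0 : Fin 3) ≤ 1)
    have h2 := hmono (by decide : (1 : Fin 3) ≤ 2)
    have h0 := hpos 0
    obtain ⟨ha, hb, hc⟩ : r 0 = 1 ∧ r 1 = 1 ∧ r 2 = 2 := by omega
    obtain rfl : r = ![1, 1, 2] := by ext i; fin_cases i <;> assumption
    exact .inr <| .inl <| key _ (by decide)
  · rw [Fin.sum_univ_four] at hr
    have h0 := hpos 0
    have h1 := hpos 1
    have h2 := hpos 2
    have h3 := hpos 3
    obtain ⟨ha, hb, hc, hd⟩ : r 0 = 1 ∧ r 1 = 1 ∧ r 2 = 1 ∧ r 3 = 1 := by omega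
    obtain rfl : r = ![1, 1, 1, 1] := by ext i; fin_cases i <;> assumption
    exact .inl <| key _ (by decide)

end Star

theorem map_sub_map {σ : 𝔤 ≃ₗ⁅ℂ⁆ 𝔤} (hσ : ∀ x, σ (σ x) = x) (y : 𝔤) : σ (y - σ y) = -(y - σ y) := by
  rw [map_sub, hσ, neg_sub]

/-! ### Consequences of indecomposability, and the degree of α_p. -/

section Degree

variable [FiniteDimensional ℂ 𝔤] [LieAlgebra.IsSemisimple ℂ 𝔤] {σ : 𝔤 ≃ₗ⁅ℂ⁆ 𝔤}

/-- For an indecomposable involution, `𝔤₀` acts faithfully on `𝔤₁`. -/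
theorem eq_zero_of_forall_lie_neg_eq_zero (hσ : ∀ x, σ (σ x) = x) (hσ_ne : ∃ x, σ x ≠ x)
    (hσ_ind : IsIndecomposableAut σ) {x : 𝔤} (hx : σ x = x)
    (h : ∀ y, σ y = -y → ⁅x, y⁆ = 0) : x = 0 := by
  -- The centraliser of 𝔤₁ in 𝔤₀ is an ideal of 𝔤. It and its Killing complement are σ-stable, so it
  -- is 0 or 𝔤; the latter would make σ trivial.
  let J : LieIdeal ℂ 𝔤 :=
    { carrier := {x | σ x = x ∧ ∀ y, σ y = -y → ⁅x, y⁆ = 0}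
      add_mem' := fun {a b} ha hb => ⟨by rw [map_add, ha.1, hb.1], fun y hy => by
        rw [add_lie, ha.2 y hy, hb.2 y hy, add_zero]⟩
      zero_mem' := ⟨map_zero σ, fun y _ => zero_lie y⟩
      smul_mem' := fun c a ha => ⟨by rw [map_smul, ha.1], fun y hy => by
        rw [smul_lie, ha.2 y hy, smul_zero]⟩
      lie_mem := fun {z a} ha => by
        have ha : σ a = a ∧ ∀ y, σ y = -y → ⁅a, y⁆ = 0 := ha
        have h1 : ⁅z, a⁆ = ⁅σ z, a⁆ := by
          rw [← sub_eq_zero, ← sub_lie, ← lie_skew, ha.2 _ (map_sub_map hσ z), neg_zero]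
        refine ⟨by rw [LieEquiv.map_lie, ha.1, ← h1], fun y hy => ?_⟩
        have h2 : ⁅⁅z + σ z, a⁆, y⁆ = 0 := by
          rw [lie_lie, ha.2 y hy, lie_zero, ha.2, sub_zero]
          rw [LieEquiv.map_lie, map_add, hσ, hy, lie_neg, add_comm]
        rw [add_lie, ← h1, ← two_smul ℂ, smul_lie] at h2
        exact (smul_eq_zero.1 h2).resolve_left two_ne_zero }
  have hJσ : ∀ y ∈ J, σ y = y := fun y hy => hy.1
  have hxJ : x ∈ J := ⟨hx, h⟩
  have hJσ' : ∀ y ∈ J.killingCompl, σ y ∈ J.killingCompl := fun y hy => by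
    rw [LieIdeal.mem_killingCompl] at hy ⊢
    intro z hz
    rw [← hy z hz, ← LieAlgebra.killingForm_of_equiv_apply σ z y, hJσ z hz]
  rcases hσ_ind J J.killingCompl (LieIdeal.isCompl_killingCompl J)
    (fun y hy => by rwa [hJσ y hy]) hJσ' with h0 | h0
  · rw [h0] at hxJ; exact hxJ
  · obtain ⟨y, hy⟩ := hσ_ne
    have hc := (LieIdeal.isCompl_killingCompl J).codisjoint
    rw [h0, codisjoint_bot] at hc
    exact absurd (hJσ y (by rw [hc]; trivial)) hy

/-- If `𝔱₀` were zero, 𝔤₀ would be zero and σ = -1; brackets, being fixed by σ, would vanish, and 𝔤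
would be zero. -/
theorem exists_cartan_ne_zero (hσ_ne : ∃ x, σ x ≠ x) (hσ : ∀ x, σ (σ x) = x)
    (𝔱₀ : LieSubalgebra ℂ (fixedSubalgebra σ)) [𝔱₀.IsCartanSubalgebra] : ∃ x : 𝔱₀, x ≠ 0 := by
  by_contra! H
  have h0 : ∀ x, σ x = x → x = 0 := fun x hx => by
    obtain ⟨z, rfl⟩ := mem_range_incl_of_forall_lie_eq_zero (𝔱₀ := 𝔱₀) hx fun y => by
      rw [H y, map_zero, zero_lie]
    rw [H z, map_zero]
  have h1 : ∀ x, σ x = -x := fun x => by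
    have := h0 (x + σ x) (by rw [map_add, hσ, add_comm])
    exact eq_neg_of_add_eq_zero_right this
  obtain ⟨x, hx⟩ := hσ_ne
  refine hx ?_
  rw [show x = 0 from eq_zero_of_forall_lie_eq_zero fun y => h0 _ ?_, map_zero]
  rw [LieEquiv.map_lie, h1, h1, neg_lie, lie_neg, neg_neg]

variable [LieAlgebra.IsSemisimple ℂ (fixedSubalgebra σ)]
  {𝔱₀ : LieSubalgebra ℂ (fixedSubalgebra σ)} [𝔱₀.IsCartanSubalgebra]

theorem exists_weight_ne_zero (hσ_ne : ∃ x, σ x ≠ x) (hσ : ∀ x, σ (σ x) = x)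
    (𝔱₀ : LieSubalgebra ℂ (fixedSubalgebra σ)) [𝔱₀.IsCartanSubalgebra] :
    ∃ (j : ℤ) (μ : Module.Dual ℂ 𝔱₀), μ ≠ 0 ∧ weightSpace σ 𝔱₀ j μ ≠ ⊥ := by
  by_contra! H
  obtain ⟨x, hx⟩ := exists_cartan_ne_zero hσ_ne hσ 𝔱₀
  refine hx (incl_injective ?_)
  rw [map_zero]
  refine eq_zero_of_forall_lie_eq_zero fun y => ?_
  induction y using induction_weightSpace hσ (𝔱₀ := 𝔱₀) with
  | mem j μ _ y hy =>
    rcases eq_or_ne μ 0 with rfl | hμ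
    · rw [(mem_weightSpace.1 hy).2]; simp
    · rw [H j μ hμ] at hy
      rw [(Submodule.mem_bot ℂ).1 hy, lie_zero]
  | add y z hy hz => rw [lie_add, hy, hz, add_zero]

/-- The simple root that is not a root of `𝔤₀` has degree one. -/
theorem degree_eq_one_of_mem_simpleRoots (hσ : ∀ x, σ (σ x) = x) (hσ_ne : ∃ x, σ x ≠ x)
    (hσ_ind : IsIndecomposableAut σ) {h : 𝔱₀} {αp : AffineWeight 𝔱₀}
    (hαp : αp ∈ simpleRoots σ 𝔱₀ h) (hαp_deg : αp.2 ≠ 0) : αp.2 = 1 := by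
  obtain ⟨⟨⟨h0, hw⟩, hpos⟩, hdec⟩ := hαp
  have hpos : 0 < αp.2 := hpos.resolve_right fun h => hαp_deg h.1
  have mem_pos : ∀ (j : ℤ) (μ : Module.Dual ℂ 𝔱₀), 0 < j → weightSpace σ 𝔱₀ j μ ≠ ⊥ →
      ((μ, j) : AffineWeight 𝔱₀) ∈ positiveRoots σ 𝔱₀ h := fun j μ hj hμ =>
    ⟨⟨fun e => hj.ne' (congrArg Prod.snd e), hμ⟩, .inl hj⟩
  rcases (by omega : αp.2 = 1 ∨ αp.2 = 2 ∨ 3 ≤ αp.2) with h1 | h2 | h3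
  · exact h1
  · exfalso
    rw [h2, weightSpace_congr (j := 0) (by decide)] at hw
    obtain ⟨x, hx, hx0⟩ := Submodule.exists_mem_ne_zero_of_ne_bot (weightSpace_neg_ne_bot hσ hw)
    rw [neg_zero] at hx
    have hxσ : σ x = x := by simpa using (mem_weightSpace.1 hx).1
    -- By faithfulness on 𝔤₁, a vector of weight -α_p moves some weight b of 𝔤₁. This writes α_p as
    -- a sum of two positive roots of degree 1.
    obtain ⟨b, y, hy, hxy⟩ : ∃ b : Module.Dual ℂ 𝔱₀, ∃ y ∈ weightSpace σ 𝔱₀ 1 b, ⁅x, y⁆ ≠ 0 := by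
      by_contra! H
      refine hx0 (eq_zero_of_forall_lie_neg_eq_zero hσ hσ_ne hσ_ind hxσ fun y hy => ?_)
      have key : ⁅x, y - σ y⁆ = 0 := by
        clear hy
        induction y using induction_weightSpace hσ (𝔱₀ := 𝔱₀) with
        | mem j μ hj y hy =>
          rcases hj with rfl | rfl
          · have : σ y = y := by simpa using (mem_weightSpace.1 hy).1
            rw [this, sub_self, lie_zero]
          · exact H μ _ (by
              have : σ y = -y := by simpa using (mem_weightSpace.1 hy).1
              rw [this, sub_neg_eq_add]; exact add_mem hy hy)
        | add y z hy hz =>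
          rw [map_add, add_sub_add_comm, lie_add, hy, hz, add_zero]
      rw [hy, sub_neg_eq_add, ← two_smul ℂ, lie_smul] at key
      exact (smul_eq_zero.1 key).resolve_left two_ne_zero
    have hb : weightSpace σ 𝔱₀ 1 b ≠ ⊥ :=
      (Submodule.ne_bot_iff _).2 ⟨y, hy, by rintro rfl; simp at hxy⟩
    have hb' : weightSpace σ 𝔱₀ 1 (αp.1 - b) ≠ ⊥ := by
      have := weightSpace_neg_ne_bot hσ
        ((Submodule.ne_bot_iff _).2 ⟨_, lie_mem_weightSpace hx hy, hxy⟩)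
      rwa [weightSpace_congr (j := 1) (by decide), neg_add, neg_neg, ← sub_eq_add_neg] at this
    exact hdec ⟨_, mem_pos 1 b one_pos hb, _, mem_pos 1 _ one_pos hb',
      Prod.ext (by simp) (by simp [h2])⟩
  · exfalso
    obtain ⟨x, hx⟩ := exists_cartan_ne_zero hσ_ne hσ 𝔱₀
    -- In degree at least 3 the root 2δ' can be split off.
    refine hdec ⟨_, mem_pos (αp.2 - 2) αp.1 (by omega) ?_, _, mem_pos 2 0 two_pos ?_,
      Prod.ext (by simp) (by simp)⟩
    · rwa [weightSpace_congr (j := αp.2) (by simp)]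
    · exact (Submodule.ne_bot_iff _).2 ⟨_, incl_mem_weightSpace even_two x,
        fun e => hx (incl_injective (e.trans (map_zero _).symm))⟩

end Degree

/-! ### The sum of the length ratios is 4. -/

section Main

variable [FiniteDimensional ℂ 𝔤] [LieAlgebra.IsSemisimple ℂ 𝔤] {σ : 𝔤 ≃ₗ⁅ℂ⁆ 𝔤}
  [LieAlgebra.IsSemisimple ℂ (fixedSubalgebra σ)]
  {𝔱₀ : LieSubalgebra ℂ (fixedSubalgebra σ)} [𝔱₀.IsCartanSubalgebra]

/-- An orthogonal family of roots of `𝔤₀` of level one with respect to a long weight `τ` of `𝔤₁`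
that is not complex, and to which no root of level one is orthogonal, spans a space that
contains `τ`. -/
theorem sum_eq_four_of_maximal (hσ : ∀ x, σ (σ x) = x) {τ : Module.Dual ℂ 𝔱₀} (hτ0 : τ ≠ 0)
    (hτ : weightSpace σ 𝔱₀ 1 τ ≠ ⊥) (hτ' : weightSpace σ 𝔱₀ 0 τ = ⊥)
    (hlong : ∀ (j : ℤ) (μ : Module.Dual ℂ 𝔱₀), weightSpace σ 𝔱₀ j μ ≠ ⊥ →
      realForm hσ 𝔱₀ μ μ ≤ realForm hσ 𝔱₀ τ τ)
    {ι : Type*} [Fintype ι] {β : ι → Module.Dual ℂ 𝔱₀} (hβ : ∀ i, weightSpace σ 𝔱₀ 0 (β i) ≠ ⊥)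
    (hβ0 : ∀ i, β i ≠ 0) (hβτ : ∀ i, 2 * realForm hσ 𝔱₀ (β i) τ = realForm hσ 𝔱₀ τ τ)
    (horth : ∀ i k, i ≠ k → realForm hσ 𝔱₀ (β i) (β k) = 0) {r : ι → ℕ}
    (hr : ∀ i, r i * realForm hσ 𝔱₀ (β i) (β i) = realForm hσ 𝔱₀ τ τ)
    (hmax : ∀ γ : Module.Dual ℂ 𝔱₀, weightSpace σ 𝔱₀ 0 γ ≠ ⊥ →
      2 * realForm hσ 𝔱₀ γ τ = realForm hσ 𝔱₀ τ τ → ∃ i, realForm hσ 𝔱₀ γ (β i) ≠ 0) :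
    ∑ i, r i = 4 := by
  have hpos := realForm_self_pos (mem_realDual hσ hτ) hτ0
  obtain ⟨v, hv, hv0⟩ := Submodule.exists_mem_ne_zero_of_ne_bot hτ
  obtain ⟨hlen, w, hw, hwv⟩ := exists_multireflected_weightVector hσ hv hv0 (hlong 1) hβ hβ0 horth
    (r := r) (fun i => by rw [hr, realForm_comm, hβτ]) Finset.univ
  have hw0 : w ≠ 0 := fun h0 => hv0 <| by
    simpa using hwv ⊥ (fun x _ y hy => by simp [(Submodule.mem_bot ℂ).1 hy]) (by simpa using h0)
  have hντ : 2 * realForm hσ 𝔱₀ (τ - ∑ i, (r i : ℝ) • β i) τ =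
      (2 - ∑ i, (r i : ℝ)) * realForm hσ 𝔱₀ τ τ := by
    simp only [map_sub, map_sum, LinearMap.sub_apply, LinearMap.sum_apply, map_smul,
      LinearMap.smul_apply, smul_eq_mul]
    rw [sub_mul, mul_sub, Finset.mul_sum, Finset.sum_mul]
    congr 1
    exact Finset.sum_congr rfl fun i _ => by rw [← hβτ i]; ring
  have hνγ : ∀ γ : Module.Dual ℂ 𝔱₀, realForm hσ 𝔱₀ (τ - ∑ i, (r i : ℝ) • β i) γ =
      realForm hσ 𝔱₀ γ τ - ∑ i, (r i : ℝ) * realForm hσ 𝔱₀ γ (β i) := fun γ => by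
    rw [realForm_comm]
    simp only [map_sub, map_sum, map_smul, smul_eq_mul]
  set ν := τ - ∑ i, (r i : ℝ) • β i with hν
  have hνw : weightSpace σ 𝔱₀ 1 ν ≠ ⊥ := (Submodule.ne_bot_iff _).2 ⟨w, hw, hw0⟩
  have hsum : realForm hσ 𝔱₀ (ν + τ) (ν + τ) = (4 - ∑ i, (r i : ℝ)) * realForm hσ 𝔱₀ τ τ := by
    simp only [map_add, LinearMap.add_apply, realForm_comm hσ τ ν]
    linear_combination hlen + hντ
  have hle : (∑ i, (r i : ℝ)) ≤ 4 := by
    have h1 := realForm_self_nonneg (add_mem (mem_realDual hσ hνw) (mem_realDual hσ hτ))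
    rw [hsum] at h1
    linarith [nonneg_of_mul_nonneg_left h1 hpos]
  by_contra hne
  have hlt : (∑ i, (r i : ℝ)) < 4 := lt_of_le_of_ne hle fun h => hne (by exact_mod_cast h)
  have hν0 : ν + τ ≠ 0 := fun h => by
    rw [h, map_zero, eq_comm] at hsum
    exact (mul_pos (sub_pos.2 hlt) hpos).ne' hsum
  obtain ⟨b, ⟨μ, hbμ, hμτ⟩, hbw⟩ :=
    exists_lie_levelVectors_ne_zero hσ hv hv0 hτ0 hτ' hlong hw hν0 hwv
  have hμw : weightSpace σ 𝔱₀ 0 μ ≠ ⊥ :=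
    (Submodule.ne_bot_iff _).2 ⟨b, hbμ, by rintro rfl; simp at hbw⟩
  have hγ : weightSpace σ 𝔱₀ 0 (-μ) ≠ ⊥ := by simpa using weightSpace_neg_ne_bot hσ hμw
  have hγτ : 2 * realForm hσ 𝔱₀ (-μ) τ = realForm hσ 𝔱₀ τ τ := by
    rw [map_neg, LinearMap.neg_apply]; push_cast at hμτ; linarith
  have hμ0 : μ ≠ 0 := by rintro rfl; simp at hμτ; exact hpos.ne' hμτ
  have hνμ : 0 < realForm hσ 𝔱₀ ν (-μ) := by
    have h1 := hlong _ _ ((Submodule.ne_bot_iff _).2 ⟨_, lie_mem_weightSpace hbμ hw, hbw⟩)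
    have h2 := realForm_self_pos (mem_realDual hσ hμw) hμ0
    simp only [map_add, LinearMap.add_apply, realForm_comm hσ μ ν] at h1
    rw [map_neg]; linarith
  generalize -μ = γ at hγ hγτ hνμ
  obtain ⟨i₀, hi₀⟩ := hmax γ hγ hγτ
  -- Otherwise γ + β_i would be a root of 𝔤₀ of level 2.
  have hnonneg : ∀ i, 0 ≤ realForm hσ 𝔱₀ γ (β i) := fun i => by
    by_contra! hneg
    have h1 := weightSpace_add_ne_bot hσ (hβ i) hγ hneg
    rw [add_zero] at h1
    obtain ⟨k, hk, hk'⟩ := two_mul_realForm_eq_of_isLong hσ hτ hτ0 hτ' hlong h1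
    rw [map_add, LinearMap.add_apply, mul_add, hβτ, hγτ] at hk'
    have : (k : ℝ) ≤ 1 := by exact_mod_cast (by omega : k ≤ 1)
    nlinarith
  choose k hk using fun i => exists_int_two_mul_realForm hσ (hβ i) (hβ0 i) hγ
  have hβpos : ∀ i, 0 < realForm hσ 𝔱₀ (β i) (β i) := fun i =>
    realForm_self_pos (mem_realDual hσ (hβ i)) (hβ0 i)
  have hk0 : ∀ i, 0 ≤ k i := fun i => by
    have : (0 : ℝ) ≤ k i := nonneg_of_mul_nonneg_left (by rw [← hk]; linarith [hnonneg i]) (hβpos i)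
    exact_mod_cast this
  -- With k_i the value of γ on the coroot of β_i, positivity of (ν,γ) forces Σ k_i < 1, so every
  -- k_i is zero.
  have hkr : 2 * realForm hσ 𝔱₀ ν γ = (1 - ∑ i, (k i : ℝ)) * realForm hσ 𝔱₀ τ τ := by
    rw [hνγ, sub_mul, mul_sub, hγτ, one_mul, Finset.sum_mul, Finset.mul_sum]
    congr 1
    exact Finset.sum_congr rfl fun i _ => by rw [← hr i]; linear_combination (r i : ℝ) * hk i
  have hk1 : (∑ i, (k i : ℝ)) < 1 := by
    have : 0 < (1 - ∑ i, (k i : ℝ)) * realForm hσ 𝔱₀ τ τ := by rw [← hkr]; linarith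
    linarith [(pos_iff_pos_of_mul_pos this).2 hpos]
  have hk1' : ∑ i, k i < 1 := by exact_mod_cast hk1
  have hki : k i₀ = 0 := by
    have := Finset.single_le_sum (fun i _ => hk0 i) (Finset.mem_univ i₀)
    have := hk0 i₀
    omega
  have := hk i₀
  rw [hki] at this
  simp at this
  exact hi₀ this

end Main

/-! ### From orthogonal subsets of `setC1` to orthogonal roots of level one. -/

section SetC

variable {σ : 𝔤 ≃ₗ⁅ℂ⁆ 𝔤} {𝔱₀ : LieSubalgebra ℂ (fixedSubalgebra σ)}

theorem mem_setC1_iff {h : 𝔱₀} {αp α : AffineWeight 𝔱₀} (hdeg : αp.2 = 1) :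
    α ∈ setC1 σ 𝔱₀ h αp ↔ α.2 = 1 ∧ weightSpace σ 𝔱₀ 1 α.1 ≠ ⊥ ∧
      weightSpace σ 𝔱₀ 0 (αp.1 - α.1) ≠ ⊥ := by
  constructor
  · rintro ⟨⟨⟨⟨-, h1⟩, -⟩, ⟨-, h2⟩, -⟩, h3⟩
    refine ⟨h3, by rwa [h3] at h1, ?_⟩
    simp only [Prod.snd_sub, Prod.snd_add, Prod.fst_sub, Prod.fst_add, add_zero, hdeg, h3] at h2
    rwa [weightSpace_congr (j := 0) (by decide)] at h2
  · rintro ⟨h3, h1, h2⟩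
    refine ⟨⟨⟨⟨fun e => ?_, by rwa [h3]⟩, .inl (by omega)⟩, ⟨fun e => ?_, ?_⟩, .inl ?_⟩, h3⟩
    · rw [e] at h3; simp at h3
    · have := congrArg Prod.snd e
      simp [hdeg, h3] at this
    · simp only [Prod.snd_sub, Prod.snd_add, Prod.fst_sub, Prod.fst_add, add_zero, hdeg, h3]
      rwa [weightSpace_congr (j := 0) (by decide)]
    · simp [hdeg, h3]

theorem realForm_sub_sub [FiniteDimensional ℂ 𝔤] [LieAlgebra.IsSemisimple ℂ 𝔤]
    [𝔱₀.IsCartanSubalgebra] (hσ : ∀ x, σ (σ x) = x) {τ β γ : Module.Dual ℂ 𝔱₀}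
    (hβ : 2 * realForm hσ 𝔱₀ β τ = realForm hσ 𝔱₀ τ τ)
    (hγ : 2 * realForm hσ 𝔱₀ γ τ = realForm hσ 𝔱₀ τ τ) :
    realForm hσ 𝔱₀ (τ - β) (τ - γ) = realForm hσ 𝔱₀ β γ := by
  simp only [map_sub, LinearMap.sub_apply, realForm_comm hσ τ γ]
  linear_combination (-1 / 2 : ℝ) * hβ + (-1 / 2 : ℝ) * hγ

variable [FiniteDimensional ℂ 𝔤] [LieAlgebra.IsSemisimple ℂ 𝔤]
  [LieAlgebra.IsSemisimple ℂ (fixedSubalgebra σ)] [𝔱₀.IsCartanSubalgebra]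

/-- The elements of `𝓒¹_σ` other than `α_p` correspond to the roots of `𝔤₀` of level one. -/
theorem two_mul_realForm_eq_of_weightSpace_sub (hσ : ∀ x, σ (σ x) = x) {τ μ : Module.Dual ℂ 𝔱₀}
    (hτ0 : τ ≠ 0) (hτ : weightSpace σ 𝔱₀ 1 τ ≠ ⊥) (hτ' : weightSpace σ 𝔱₀ 0 τ = ⊥)
    (hlong : ∀ (j : ℤ) (μ : Module.Dual ℂ 𝔱₀), weightSpace σ 𝔱₀ j μ ≠ ⊥ →
      realForm hσ 𝔱₀ μ μ ≤ realForm hσ 𝔱₀ τ τ)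
    (hμ : weightSpace σ 𝔱₀ 1 μ ≠ ⊥) (hβ : weightSpace σ 𝔱₀ 0 (τ - μ) ≠ ⊥) (hne : μ ≠ τ) :
    2 * realForm hσ 𝔱₀ (τ - μ) τ = realForm hσ 𝔱₀ τ τ := by
  have hpos := realForm_self_pos (mem_realDual hσ hτ) hτ0
  have hβpos := realForm_self_pos (mem_realDual hσ hβ) (sub_ne_zero.2 hne.symm)
  obtain ⟨k, hk, hkτ⟩ := two_mul_realForm_eq_of_isLong hσ hτ hτ0 hτ' hlong hβ
  have h1 := hlong 1 μ hμ
  have h2 : realForm hσ 𝔱₀ μ μ = realForm hσ 𝔱₀ τ τ - 2 * realForm hσ 𝔱₀ (τ - μ) τ +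
      realForm hσ 𝔱₀ (τ - μ) (τ - μ) := by
    simp only [map_sub, LinearMap.sub_apply, realForm_comm hσ τ μ]; ring
  -- For levels -1 and 0 the weight μ would be longer than τ.
  rcases hk with rfl | rfl | rfl
  · push_cast at hkτ; linarith
  · push_cast at hkτ; linarith
  · push_cast at hkτ; linarith

/-- The numerical content of the theorem: an orthogonal subset `S` of `𝓒¹_σ` of maximal
cardinality is finite, the ratios `(α_p, α_p) / (η, η)` for `η ∈ S` are integers with sum `4`, and
`2 (η, α_p) = (α_p, α_p)`. -/
theorem exists_ratio (hσ : ∀ x, σ (σ x) = x) {h : 𝔱₀} {αp : AffineWeight 𝔱₀} (hdeg : αp.2 = 1)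
    (hτ0 : αp.1 ≠ 0) (hτ : weightSpace σ 𝔱₀ 1 αp.1 ≠ ⊥) (hτ' : weightSpace σ 𝔱₀ 0 αp.1 = ⊥)
    (hlong : ∀ (j : ℤ) (μ : Module.Dual ℂ 𝔱₀), weightSpace σ 𝔱₀ j μ ≠ ⊥ →
      realForm hσ 𝔱₀ μ μ ≤ realForm hσ 𝔱₀ αp.1 αp.1)
    {S : Set (AffineWeight 𝔱₀)} (hS : S ⊆ setC1 σ 𝔱₀ h αp \ {αp}) (hS_orth : IsOrthogonalSet S)
    (hS_max : ∀ T : Set (AffineWeight 𝔱₀), T ⊆ setC1 σ 𝔱₀ h αp \ {αp} → IsOrthogonalSet T →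
      T.encard ≤ S.encard) :
    ∃ (_ : Fintype S) (r : S → ℕ), ∑ i, r i = 4 ∧
      (∀ i : S, r i * realForm hσ 𝔱₀ i.1.1 i.1.1 = realForm hσ 𝔱₀ αp.1 αp.1) ∧
      ∀ i : S, 2 * realForm hσ 𝔱₀ i.1.1 αp.1 = realForm hσ 𝔱₀ αp.1 αp.1 := by
  have hpos := realForm_self_pos (mem_realDual hσ hτ) hτ0
  have hmem : ∀ i : S, i.1.2 = 1 ∧ weightSpace σ 𝔱₀ 1 i.1.1 ≠ ⊥ ∧
      weightSpace σ 𝔱₀ 0 (αp.1 - i.1.1) ≠ ⊥ := fun i => (mem_setC1_iff hdeg).1 (hS i.2).1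
  have hne : ∀ i : S, i.1.1 ≠ αp.1 := fun i e =>
    (hS i.2).2 (Prod.ext e ((hmem i).1.trans hdeg.symm))
  have hfin : S.Finite := by
    refine ((finite_weights 𝔱₀ 1).image fun μ => ((μ, 1) : AffineWeight 𝔱₀)).subset fun α hα => ?_
    exact ⟨α.1, (hmem ⟨α, hα⟩).2.1, Prod.ext rfl (hmem ⟨α, hα⟩).1.symm⟩
  let : Fintype S := hfin.fintype
  have hβτ : ∀ i : S, 2 * realForm hσ 𝔱₀ (αp.1 - i.1.1) αp.1 = realForm hσ 𝔱₀ αp.1 αp.1 :=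
    fun i => two_mul_realForm_eq_of_weightSpace_sub hσ hτ0 hτ hτ' hlong (hmem i).2.1
      (hmem i).2.2 (hne i)
  have hβ0 : ∀ i : S, αp.1 - i.1.1 ≠ 0 := fun i => sub_ne_zero.2 (hne i).symm
  have hβpos : ∀ i : S, 0 < realForm hσ 𝔱₀ (αp.1 - i.1.1) (αp.1 - i.1.1) := fun i =>
    realForm_self_pos (mem_realDual hσ (hmem i).2.2) (hβ0 i)
  have hββ : ∀ i k : S, realForm hσ 𝔱₀ (αp.1 - i.1.1) (αp.1 - k.1.1) =
      realForm hσ 𝔱₀ i.1.1 k.1.1 := fun i k => by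
    rw [← realForm_sub_sub hσ (hβτ i) (hβτ k), sub_sub_cancel, sub_sub_cancel]
  have hr : ∀ i : S, ∃ r : ℕ, r * realForm hσ 𝔱₀ (αp.1 - i.1.1) (αp.1 - i.1.1) =
      realForm hσ 𝔱₀ αp.1 αp.1 := fun i => by
    obtain ⟨k, hk⟩ := exists_int_two_mul_realForm hσ (hmem i).2.2 (hβ0 i) hτ
    rw [realForm_comm, hβτ] at hk
    have : (0 : ℝ) ≤ k := nonneg_of_mul_nonneg_left (by rw [← hk]; exact hpos.le) (hβpos i)
    lift k to ℕ using by exact_mod_cast this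
    exact ⟨k, by rw [hk]; simp⟩
  choose r hr using hr
  refine ⟨inferInstance, r, ?_, fun i => by rw [← hββ, hr], fun i => ?_⟩
  · refine sum_eq_four_of_maximal hσ hτ0 hτ hτ' hlong (β := fun i : S => αp.1 - i.1.1)
      (fun i => (hmem i).2.2) hβ0 hβτ (fun i k hik => ?_) hr fun γ hγ hγτ => ?_
    · rw [hββ, ← form_re, hS_orth i.2 k.2 (fun e => hik (Subtype.ext e)), Complex.zero_re]
    -- A level-one root γ orthogonal to every β_i would allow τ - γ to be added to S.
    · by_contra! H
      have hγ0 : γ ≠ 0 := by rintro rfl; simp at hγτ; exact hτ0 (by_contra fun _ => hpos.ne hγτ)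
      have hγw : weightSpace σ 𝔱₀ 1 (αp.1 - γ) ≠ ⊥ := by
        simpa using weightSpace_sub_ne_bot hσ hγ hτ (by rw [realForm_comm]; linarith)
      have hform : ∀ α ∈ S, form ((αp.1 - γ, 1) : AffineWeight 𝔱₀) α = 0 := fun α hα => by
        rw [form_eq_realForm hσ hγw (hmem ⟨α, hα⟩).2.1]
        have := realForm_sub_sub hσ hγτ (hβτ ⟨α, hα⟩)
        rw [H ⟨α, hα⟩, sub_sub_cancel] at this
        exact_mod_cast this
      have hform_comm : ∀ α β : AffineWeight 𝔱₀, form α β = form β α := fun α β => by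
        rw [form_eq hσ, form_eq hσ, weight_apply_dualElement_comm hσ]
      have hnot : ((αp.1 - γ, 1) : AffineWeight 𝔱₀) ∉ S := fun hmemS => by
        have h1 := H ⟨_, hmemS⟩
        simp only [sub_sub_cancel] at h1
        exact (realForm_self_pos (mem_realDual hσ hγ) hγ0).ne' h1
      have h1 := hS_max (insert (αp.1 - γ, 1) S) (Set.insert_subset ⟨?_, fun e => ?_⟩ hS) ?_
      · rw [Set.encard_insert_of_notMem hnot] at h1
        exact absurd h1 (not_le.2 (ENat.lt_add_one_iff hfin.encard_lt_top.ne |>.2 le_rfl))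
      · rw [mem_setC1_iff hdeg]
        exact ⟨rfl, hγw, by rwa [sub_sub_cancel]⟩
      · have := congrArg Prod.fst (Set.mem_singleton_iff.1 e)
        exact hγ0 (by simpa using this)
      · refine Set.pairwise_insert.2
          ⟨hS_orth, fun α hα _ => ⟨hform α hα, by rw [hform_comm, hform α hα]⟩⟩
  · have := hβτ i
    rw [map_sub, LinearMap.sub_apply] at this
    linarith

end SetC

end InvolutionRoots

theorem mainTheorem11 {𝔤 : Type*} [LieRing 𝔤] [LieAlgebra ℂ 𝔤] [FiniteDimensional ℂ 𝔤]
    [LieAlgebra.IsSemisimple ℂ 𝔤]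
    (σ : 𝔤 ≃ₗ⁅ℂ⁆ 𝔤) (hσ : ∀ x, σ (σ x) = x) (hσ_ne : ∃ x, σ x ≠ x)
    (hσ_ind : IsIndecomposableAut σ)
    (hfix : LieAlgebra.IsSemisimple ℂ (fixedSubalgebra σ))
    (𝔱₀ : LieSubalgebra ℂ (fixedSubalgebra σ)) [𝔱₀.IsCartanSubalgebra]
    (h : 𝔱₀) (hreg : IsRegularElement σ 𝔱₀ h)
    (αp : AffineWeight 𝔱₀) (hαp : αp ∈ simpleRoots σ 𝔱₀ h) (hαp_deg : αp.2 ≠ 0)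
    (hlong : IsLong σ 𝔱₀ αp) (hnc : ¬ IsComplexRoot σ 𝔱₀ αp)
    (S : Set (AffineWeight 𝔱₀)) (hS : S ⊆ setC1 σ 𝔱₀ h αp \ {αp})
    (hS_orth : IsOrthogonalSet S)
    (hS_max : ∀ T : Set (AffineWeight 𝔱₀), T ⊆ setC1 σ 𝔱₀ h αp \ {αp} → IsOrthogonalSet T →
      T.encard ≤ S.encard) :
    S.encard ≤ 4 ∧
      ∃ (_ : Fintype ↥(S ∪ {-αp})) (A : Matrix ↥(S ∪ {-αp}) ↥(S ∪ {-αp}) ℤ),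
        pairingMatrix (S ∪ {-αp}) = A.map (Int.cast : ℤ → ℂ) ∧
        IsAffineGCM A ∧
        (IsOfType A cartanD41 ∨ IsOfType A cartanB31 ∨ IsOfType A cartanD32 ∨
          IsOfType A cartanG21 ∨ IsOfType A cartanA22) := by
  have hdeg := degree_eq_one_of_mem_simpleRoots hσ hσ_ne hσ_ind hαp hαp_deg
  have hτ : weightSpace σ 𝔱₀ 1 αp.1 ≠ ⊥ := by
    have := hαp.1.1.2
    rwa [hdeg] at this
  have hlong' : ∀ (j : ℤ) (μ : Module.Dual ℂ 𝔱₀), weightSpace σ 𝔱₀ j μ ≠ ⊥ →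
      realForm hσ 𝔱₀ μ μ ≤ realForm hσ 𝔱₀ αp.1 αp.1 := fun j μ hμ => by
    rcases eq_or_ne μ 0 with rfl | hμ0
    · simpa using realForm_self_nonneg (mem_realDual hσ hτ)
    · have := hlong (μ, j) ⟨fun e => hμ0 (congrArg Prod.fst e), hμ⟩
      rwa [form_re hσ, form_re hσ] at this
  -- If α_p restricted to zero, being long would leave no room for a non-zero weight, whose square
  -- length is positive.
  have hτ0 : αp.1 ≠ 0 := fun h0 => by
    obtain ⟨j, μ, hμ0, hμ⟩ := exists_weight_ne_zero hσ_ne hσ 𝔱₀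
    have h1 := hlong' j μ hμ
    have h2 := realForm_self_pos (mem_realDual hσ hμ) hμ0
    rw [h0] at h1
    simp at h1
    linarith
  have hτ' : weightSpace σ 𝔱₀ 0 αp.1 = ⊥ := by
    by_contra h0
    exact hnc ⟨⟨hτ0, h0⟩, ⟨hτ0, hτ⟩⟩
  obtain ⟨hfin, r, hsum, hr, hητ⟩ := exists_ratio hσ hdeg hτ0 hτ hτ' hlong' hS hS_orth hS_max
  have hpos := realForm_self_pos (mem_realDual hσ hτ) hτ0
  have hrpos : ∀ i, 0 < r i := fun i => Nat.pos_of_ne_zero fun h0 => by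
    have := hr i
    rw [h0] at this
    simp at this
    exact hτ0 (by_contra fun _ => hpos.ne this)
  have hcard : Fintype.card S ≤ 4 := by
    rw [← hsum]
    simpa using Finset.card_nsmul_le_sum Finset.univ r 1 fun i _ => hrpos i
  refine ⟨by rw [Set.encard_eq_coe_toFinset_card, Set.toFinset_card]; exact_mod_cast hcard, ?_⟩
  obtain ⟨n, ⟨e₀⟩⟩ := Finite.exists_equiv_fin S
  -- Sorting by r matches the order of the rows in the tabulated matrices.
  let e₁ : Fin n ≃ S := (Tuple.sort (r ∘ e₀.symm)).trans e₀.symm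
  have hmono : Monotone (r ∘ e₁) := Tuple.monotone_sort (r ∘ e₀.symm)
  have hαp_notMem : -αp ∉ S := fun h0 => by
    have := ((mem_setC1_iff hdeg).1 (hS h0).1).1
    simp [hdeg] at this
  let e : Fin (n + 1) ≃ ↥(S ∪ {-αp}) := Equiv.ofBijective
    (Fin.cons ⟨-αp, .inr rfl⟩ fun i => ⟨e₁ i, .inl (e₁ i).2⟩) <| by
      refine ⟨Fin.cons_injective_iff.2 ⟨?_, fun i j hij => ?_⟩, ?_⟩
      · rintro ⟨i, hi⟩
        have hi' : (e₁ i : AffineWeight 𝔱₀) = -αp := congrArg Subtype.val hi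
        exact hαp_notMem (hi' ▸ (e₁ i).2)
      · exact e₁.injective (Subtype.ext (congrArg (fun x : ↥(S ∪ {-αp}) => x.1) hij))
      · rintro ⟨x, hx | hx⟩
        · exact ⟨(e₁.symm ⟨x, hx⟩).succ, by simp⟩
        · exact ⟨0, Subtype.ext hx.symm⟩
  have he0 : (e 0 : AffineWeight 𝔱₀) = -αp := rfl
  have hes : ∀ i : Fin n, (e i.succ : AffineWeight 𝔱₀) = e₁ i := fun i => rfl
  have hsum' : ∑ i, (r ∘ e₁) i = 4 := by rw [← hsum]; exact Equiv.sum_comp e₁ r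
  let : Fintype ↥(S ∪ {-αp}) := Fintype.ofEquiv _ e
  refine ⟨inferInstance, (starMatrix (r ∘ e₁)).submatrix e.symm e.symm, ?_,
    (isAffineGCM_starMatrix (fun i => hrpos _) hsum').submatrix e.symm,
    isOfType_starMatrix (fun i => hrpos _) hsum' hmono e.symm⟩
  have hηw : ∀ i : S, weightSpace σ 𝔱₀ 1 i.1.1 ≠ ⊥ := fun i =>
    ((mem_setC1_iff hdeg).1 (hS i.2).1).2.1
  have hηpos : ∀ i : S, realForm hσ 𝔱₀ i.1.1 i.1.1 ≠ 0 := fun i h0 => by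
    have := hr i
    rw [h0, mul_zero] at this
    exact hpos.ne this
  have hτneg : weightSpace σ 𝔱₀ (-1) (-αp).1 ≠ ⊥ := weightSpace_neg_ne_bot hσ hτ
  have key : ∀ a b : Fin (n + 1), pairingMatrix (S ∪ {-αp}) (e a) (e b) =
      (starMatrix (r ∘ e₁) a b : ℂ) := by
    intro a b
    change 2 * form (e b : AffineWeight 𝔱₀) (e a) / form (e a : AffineWeight 𝔱₀) (e a) = _
    refine Fin.cases ?_ (fun i => ?_) a <;> refine Fin.cases ?_ (fun j => ?_) b
    · rw [he0, form_eq_realForm hσ hτneg hτneg, starMatrix_zero_zero]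
      have : (realForm hσ 𝔱₀ αp.1 αp.1 : ℂ) ≠ 0 := by exact_mod_cast hpos.ne'
      simp only [Prod.fst_neg, map_neg, LinearMap.neg_apply, neg_neg]
      field_simp
      norm_num
    · rw [he0, hes, form_eq_realForm hσ hτneg hτneg, form_eq_realForm hσ (hηw _) hτneg,
        starMatrix_zero_succ]
      have h1 : (realForm hσ 𝔱₀ αp.1 αp.1 : ℂ) ≠ 0 := by exact_mod_cast hpos.ne'
      have h2 : 2 * (realForm hσ 𝔱₀ (e₁ j).1.1 αp.1 : ℂ) = realForm hσ 𝔱₀ αp.1 αp.1 := by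
        exact_mod_cast hητ (e₁ j)
      simp only [Prod.fst_neg, map_neg, LinearMap.neg_apply, neg_neg]
      push_cast
      rw [mul_neg, h2, neg_div, div_self h1]
    · rw [he0, hes, form_eq_realForm hσ (hηw _) (hηw _), form_eq_realForm hσ hτneg (hηw _),
        starMatrix_succ_zero]
      have h1 : (realForm hσ 𝔱₀ (e₁ i).1.1 (e₁ i).1.1 : ℂ) ≠ 0 := by exact_mod_cast hηpos (e₁ i)
      have h2 : 2 * (realForm hσ 𝔱₀ αp.1 (e₁ i).1.1 : ℂ) =
          r (e₁ i) * realForm hσ 𝔱₀ (e₁ i).1.1 (e₁ i).1.1 := by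
        exact_mod_cast (by rw [realForm_comm, hητ, hr] : 2 * realForm hσ 𝔱₀ αp.1 (e₁ i).1.1 = _)
      simp only [Prod.fst_neg, map_neg, LinearMap.neg_apply, Function.comp_apply]
      push_cast
      rw [mul_neg, h2, neg_div, mul_div_assoc, div_self h1, mul_one]
    · rw [hes, hes, starMatrix_succ_succ]
      by_cases hij : i = j
      · subst hij
        have h1 : (realForm hσ 𝔱₀ (e₁ i).1.1 (e₁ i).1.1 : ℂ) ≠ 0 := by
          exact_mod_cast hηpos (e₁ i)
        rw [form_eq_realForm hσ (hηw _) (hηw _), mul_div_assoc, div_self h1]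
        simp
      · rw [hS_orth (e₁ j).2 (e₁ i).2 fun e => hij (e₁.injective (Subtype.ext e)).symm]
        simp [hij]
  ext a b
  simpa using key (e.symm a) (e.symm b)
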